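/- Let $\mathbb{T}$ be the unit circle in $\mathbb{C}$ and let $H(\mathbb{T})$ be the group, under pointwise multiplication, of all (not necessarily continuous) group homomorphisms $\mathbb{T}\to\mathbb{T}$, with the topology of pointwise convergence. Let $\mathbb{T}_Q=\{e^{2\pi i q}: q\in\mathbb{Q}\}$, and let $s(k,j)$ be the (signed) Stirling numbers of the first kind, so that $X(X-1)\cdots(X-k+1)=\sum_{j=0}^k s(k,j)X^j$. Let $\mathcal{H}\subseteq H(\mathbb{T})^{\{0,1,2,\ldots\}}$ be the set of all sequences $(\phi_k)_{k\ge 0}$ such that $\phi_0=\mathrm{id}_{\mathbb{T}}$ and \[\phi_k(x^{k!})=\prod_{j=1}^{k}\phi_1^{(j)}\bigl(x^{s(k,j)}\bigr)\qquad\text{for all }k\ge 1,\ x\in\mathbb{T}_Q,\] where $\phi_1^{(j)}$ is the $j$-fold composition of $\phi_1$ with itself. Then $\mathcal{H}$ is a compact Hausdorff space, and $T(\phi_0,\phi_1,\phi_2,\ldots)=(\phi_0,\phi_0\phi_1,\phi_1\phi_2,\ldots)$ restricts to a homeomorphism of $\mathcal{H}$. A system $(X,s)$ is a compact Hausdorff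 space $X$ with a homeomorphism $s\colon X\to X$. It is minimal if $X\neq\emptyset$ and the only non-empty closed set $A\subseteq X$ with $s(A)=A$ is $X$. A system $(Y,t)$ is a factor of $(X,s)$ if there is a homomorphism $\pi\colon X\to Y$, that is, a continuous surjection with $\pi\circ s=t\circ\pi$; the two systems are isomorphic if there is an injective homomorphism $X\to Y$. Let $G_0(X,s)$ be the set of constant functions $X\to\mathbb{T}$, and let $G_{m+1}(X,s)$ be the set of continuous $g\colon X\to\mathbb{T}$ with $g\circ s=f\cdot g$ for some $f\in G_m(X,s)$. The system $(X,s)$ has (topological) quasi-discrete spectrum if the linear span of $\bigcup_{m\ge 0}G_m(X,s)$ is dense in $C(X,\mathbb{C})$ with the supremum norm. **Statement.** The system $(\mathcal{H},T)$ is the universal minimal system with quasi-discrete spectrum. That is, $(\mathcal{H},T)$ is minimal and has quasi-discrete spectrum, and every minimal system with quasi-discrete spectrum is a factor of it; moreover, every minimal system with quasi-discrete spectrum of which all minimal systems with quasi-discrete spectrum are factors is isomorphic to $(\mathcal{H},T)$. -/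

import Mathlib

universe u v

namespace TopDyn

/-! ### Topological dynamical systems

A system is a compact Hausdorff space `X` together with a homeomorphism `s : X ≃ₜ X`. -/

section Systems

variable {X Y : Type*} [TopologicalSpace X] [TopologicalSpace Y]

/-- `(X, s)` is minimal: `X` is non-empty, and the only non-empty closed invariant subset
(invariant means `s(A) = A`) is `X` itself. -/
def IsMinimalSystem (s : X ≃ₜ X) : Prop :=
  Nonempty X ∧ ∀ A : Set X, IsClosed A → A.Nonempty → s '' A = A → A = Set.univ

/-- A homomorphism `(X, s) → (Y, t)`: a continuous equivariant surjection. -/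
structure IsSystemHom (s : X ≃ₜ X) (t : Y ≃ₜ Y) (π : X → Y) : Prop where
  continuous : Continuous π
  surjective : Function.Surjective π
  equivariant : ∀ x, π (s x) = t (π x)

/-- `(Y, t)` is a factor of `(X, s)`. -/
def IsFactorOf (t : Y ≃ₜ Y) (s : X ≃ₜ X) : Prop :=
  ∃ π : X → Y, IsSystemHom s t π

/-- `(X, s)` and `(Y, t)` are isomorphic: there is an injective homomorphism `(X, s) → (Y, t)`. -/
def IsIsomorphicTo (s : X ≃ₜ X) (t : Y ≃ₜ Y) : Prop :=
  ∃ π : X → Y, IsSystemHom s t π ∧ Function.Injective π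

/-- The sets `G_m(X, s) ⊆ C(X, 𝕋)`: `G_0` consists of the constant functions, and `G_{m+1}` of
those continuous `g : X → 𝕋` with `g ∘ s = f * g` for some `f` in `G_m`. -/
def quasiEigen (s : X ≃ₜ X) : ℕ → Set C(X, Circle)
  | 0 => {g | ∃ c : Circle, ∀ x, g x = c}
  | m + 1 => {g | ∃ f ∈ quasiEigen s m, ∀ x, g (s x) = f x * g x}

/-- The quasi-eigenfunctions of `(X, s)`, viewed as complex-valued continuous functions. -/
def quasiEigenfunctions (s : X ≃ₜ X) : Set C(X, ℂ) :=
  {F | ∃ m : ℕ, ∃ g ∈ quasiEigen s m, ∀ x, F x = (g x : ℂ)}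

/-- `(X, s)` has topological quasi-discrete spectrum: the linear span of the quasi-eigenfunctions
is dense in `C(X, ℂ)` (whose topology, for compact `X`, is that of the supremum norm). -/
def HasQuasiDiscreteSpectrum (s : X ≃ₜ X) : Prop :=
  Dense (Submodule.span ℂ (quasiEigenfunctions s) : Set C(X, ℂ))

end Systems

/-- `(X, s)` is a universal minimal system with quasi-discrete spectrum: it is a minimal system
with quasi-discrete spectrum, and every minimal system with quasi-discrete spectrum is a factor
of it. -/
def IsUniversalMinimalQDS {X : Type v} [TopologicalSpace X] [CompactSpace X] [T2Space X]
    (s : X ≃ₜ X) : Prop :=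
  IsMinimalSystem s ∧ HasQuasiDiscreteSpectrum s ∧
    ∀ (Y : Type u) [TopologicalSpace Y] [CompactSpace Y] [T2Space Y] (t : Y ≃ₜ Y),
      IsMinimalSystem t → HasQuasiDiscreteSpectrum t → IsFactorOf t s

/-! ### The automorphism `A_G` of `G^ℕ` -/

section Skew

variable (G : Type*) [CommGroup G]

/-- The inverse of `(g₀, g₁, g₂, …) ↦ (g₀, g₀ g₁, g₁ g₂, …)`. -/
def skewInv (g : ℕ → G) : ℕ → G
  | 0 => g 0
  | k + 1 => (skewInv g k)⁻¹ * g (k + 1)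

/-- The homeomorphism `A_G (g₀, g₁, g₂, …) = (g₀, g₀ g₁, g₁ g₂, …)` of `G^ℕ`. -/
def skewShift [TopologicalSpace G] [IsTopologicalGroup G] : (ℕ → G) ≃ₜ (ℕ → G) where
  toFun g k := match k with
    | 0 => g 0
    | k + 1 => g k * g (k + 1)
  invFun := skewInv G
  left_inv g := by
    funext k
    induction k with
    | zero => rfl
    | succ k ih => simp only [skewInv] at ih ⊢; rw [ih]; simp
  right_inv g := by
    funext k
    cases k with
    | zero => rfl
    | succ k => simp [skewInv]
  continuous_toFun := by
    refine continuous_pi fun k => ?_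
    cases k with
    | zero => exact continuous_apply 0
    | succ k => exact (continuous_apply k).mul (continuous_apply (k + 1))
  continuous_invFun := by
    refine continuous_pi fun k => ?_
    induction k with
    | zero => exact continuous_apply 0
    | succ k ih => exact ih.inv.mul (continuous_apply (k + 1))

end Skew

/-! ### The endomorphism group `H(𝕋)` of the circle -/

/-- `H(𝕋)`: all (not necessarily continuous) group homomorphisms `𝕋 → 𝕋`, with the pointwise
product. -/
abbrev EndT : Type := Circle →* Circle

/-- The topology of pointwise convergence, i.e. that of a subspace of `𝕋^𝕋`. -/
noncomputable instance : TopologicalSpace EndT :=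
  TopologicalSpace.induced (fun φ : EndT => (φ : Circle → Circle)) inferInstance

theorem isClosedEmbedding_coe :
    Topology.IsClosedEmbedding (fun φ : EndT => (φ : Circle → Circle)) :=
  ⟨⟨⟨rfl⟩, DFunLike.coe_injective⟩, MonoidHom.isClosed_range_coe Circle Circle⟩

theorem continuous_eval (x : Circle) : Continuous fun φ : EndT => φ x :=
  (continuous_apply x).comp isClosedEmbedding_coe.continuous

instance : IsTopologicalGroup EndT :=
  topologicalGroup_induced (MonoidHom.coeFn Circle Circle)

instance : CompactSpace EndT := isClosedEmbedding_coe.compactSpace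

instance : T2Space EndT := isClosedEmbedding_coe.isEmbedding.t2Space

/-- The homeomorphism `T = A_{H(𝕋)}` of `H(𝕋)^ℕ`. -/
noncomputable def T : (ℕ → EndT) ≃ₜ (ℕ → EndT) := skewShift EndT

/-! ### The space `𝓗` -/

/-- The group `𝕋_Q = {exp(2πiq) : q ∈ ℚ}`. -/
def torsionT : Set Circle := {x | ∃ q : ℚ, x = Circle.exp (2 * Real.pi * q)}

/-- The (signed) Stirling numbers of the first kind: `s(k, j)` is the coefficient of `X ^ j` in
`X (X - 1) ⋯ (X - k + 1)`. -/
noncomputable def stirling (k j : ℕ) : ℤ := (descPochhammer ℤ k).coeff j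

/-- The space `𝓗` of all sequences `(φ_k)` in `H(𝕋)` with `φ_0 = id` and
`φ_k (x ^ k!) = ∏_{j=1}^k φ_1^{(j)} (x ^ s(k, j))` for all `x ∈ 𝕋_Q` and `k ≥ 1`, where
`φ_1^{(j)}` is the `j`-fold composition. -/
def H : Set (ℕ → EndT) :=
  {φ | φ 0 = MonoidHom.id Circle ∧
    ∀ k : ℕ, 1 ≤ k → ∀ x ∈ torsionT,
      φ k (x ^ k.factorial) = ∏ j ∈ Finset.Icc 1 k, (φ 1)^[j] (x ^ stirling k j)}

/-! ### `𝓗` is closed and `T`-invariant -/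

theorem exists_primitive (N : ℕ) (hN : 0 < N) :
    ∃ ζ : Circle, ζ ^ N = 1 ∧ ∀ x : Circle, x ^ N = 1 → ∃ i : ℕ, x = ζ ^ i := by
  have : NeZero N := ⟨hN.ne'⟩
  have hprim := Complex.isPrimitiveRoot_exp N hN.ne'
  have hcoe : ((Circle.exp (2 * Real.pi / N) : Circle) : ℂ)
      = Complex.exp (2 * Real.pi * Complex.I / N) := by
    rw [Circle.coe_exp]; congr 1; push_cast; ring
  refine ⟨Circle.exp (2 * Real.pi / N), ?_, fun x hx => ?_⟩
  · apply Circle.coe_injective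
    rw [Circle.coe_pow, hcoe, hprim.pow_eq_one, Circle.coe_one]
  · have hx' : (x : ℂ) ^ N = 1 := by rw [← Circle.coe_pow, hx, Circle.coe_one]
    obtain ⟨i, -, hi⟩ := hprim.eq_pow_of_pow_eq_one hx'
    refine ⟨i, Circle.coe_injective ?_⟩
    rw [Circle.coe_pow, hcoe, hi]

/-- On `N`-torsion, an endomorphism is a power map. -/
theorem exists_power (f : EndT) (N : ℕ) (hN : 0 < N) :
    ∃ m < N, ∀ y : Circle, y ^ N = 1 → f y = y ^ (m : ℤ) := by
  obtain ⟨ζ, hζ, hgen⟩ := exists_primitive N hN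
  obtain ⟨m, hm⟩ := hgen (f ζ) (by rw [← map_pow, hζ, map_one])
  refine ⟨m % N, Nat.mod_lt _ hN, fun y hy => ?_⟩
  obtain ⟨i, rfl⟩ := hgen y hy
  have hm' : f ζ = ζ ^ (m % N) := by
    rw [hm]; conv_lhs => rw [← Nat.div_add_mod m N, pow_add, pow_mul, hζ, one_pow, one_mul]
  rw [map_pow, hm', zpow_natCast, ← pow_mul, ← pow_mul, mul_comm]

theorem mem_torsionT {x : Circle} : x ∈ torsionT ↔ ∃ N : ℕ, 0 < N ∧ x ^ N = 1 := by
  constructor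
  · rintro ⟨q, rfl⟩
    refine ⟨q.den, q.den_pos, ?_⟩
    rw [← Circle.exp_natCast_mul, Circle.exp_eq_one]
    refine ⟨q.num, ?_⟩
    have : (q : ℝ) * q.den = q.num := by exact_mod_cast q.mul_den_eq_num
    linear_combination 2 * Real.pi * this
  · rintro ⟨N, hN, hx⟩
    have hprim := Complex.isPrimitiveRoot_exp N hN.ne'
    have : NeZero N := ⟨hN.ne'⟩
    have hx' : (x : ℂ) ^ N = 1 := by rw [← Circle.coe_pow, hx, Circle.coe_one]
    obtain ⟨i, -, hi⟩ := hprim.eq_pow_of_pow_eq_one hx'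
    refine ⟨(i / N : ℚ), Circle.coe_injective ?_⟩
    rw [← hi, Circle.coe_exp, ← Complex.exp_nat_mul]
    congr 1; push_cast; ring

theorem sum_stirling (m : ℤ) (k : ℕ) (hk : 1 ≤ k) :
    ∑ j ∈ Finset.Icc 1 k, stirling k j * m ^ j = k.factorial * Ring.choose m k := by
  have h := Ring.descPochhammer_eq_factorial_smul_choose m k
  rw [← Polynomial.eval_eq_smeval, Polynomial.eval_eq_sum_range,
    descPochhammer_natDegree, Finset.sum_range_succ'] at h
  obtain ⟨n, rfl⟩ : ∃ n, k = n + 1 := ⟨k - 1, by omega⟩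
  have h0 : (descPochhammer ℤ (n + 1)).coeff 0 = 0 := by
    rw [descPochhammer_succ_left]; simp
  rw [h0] at h
  rw [nsmul_eq_mul] at h
  rw [← h, Finset.range_eq_Ico, Finset.sum_Ico_add' (fun j => (descPochhammer ℤ (n+1)).coeff j * m ^ j)]
  simp [stirling, Finset.Ico_add_one_right_eq_Icc]

theorem prod_stirling {f : EndT} {N : ℕ} {m : ℤ} (hf : ∀ y : Circle, y ^ N = 1 → f y = y ^ m)
    {x : Circle} (hx : x ^ N = 1) {k : ℕ} (hk : 1 ≤ k) :
    ∏ j ∈ Finset.Icc 1 k, f^[j] (x ^ stirling k j)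
      = (x ^ k.factorial) ^ (Ring.choose m k) := by
  have hz : ∀ a : ℤ, (x ^ a) ^ N = 1 := fun a => by
    rw [← zpow_natCast, ← zpow_mul, mul_comm, zpow_mul, zpow_natCast, hx, one_zpow]
  have hit : ∀ (j : ℕ) (a : ℤ), f^[j] (x ^ a) = x ^ (a * m ^ j) := by
    intro j
    induction j with
    | zero => simp
    | succ j ih =>
      intro a
      rw [Function.iterate_succ_apply', ih, hf _ (hz _), ← zpow_mul, mul_assoc, ← pow_succ]
  rw [Finset.prod_congr rfl fun j _ => hit j (stirling k j), ← zpow_natCast, ← zpow_mul,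
    ← sum_stirling m k hk]
  induction (Finset.Icc 1 k) using Finset.induction_on with
  | empty => simp
  | insert a s ha ih => rw [Finset.prod_insert ha, Finset.sum_insert ha, zpow_add, ih]

theorem mem_H_iff {φ : ℕ → EndT} : φ ∈ H ↔ φ 0 = MonoidHom.id Circle ∧
    ∀ N : ℕ, 0 < N → ∀ m : ℤ, (∀ y : Circle, y ^ N = 1 → φ 1 y = y ^ m) →
      ∀ k : ℕ, 1 ≤ k → ∀ x : Circle, x ^ N = 1 →
        φ k (x ^ k.factorial) = (x ^ k.factorial) ^ (Ring.choose m k) := by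
  refine and_congr_right fun _ => ⟨fun h N hN m hm k hk x hx => ?_, fun h k hk x hx => ?_⟩
  · rw [h k hk x (mem_torsionT.2 ⟨N, hN, hx⟩), prod_stirling hm hx hk]
  · obtain ⟨N, hN, hx⟩ := mem_torsionT.1 hx
    obtain ⟨m, -, hm⟩ := exists_power (φ 1) N hN
    rw [h N hN m hm k hk x hx, prod_stirling hm hx hk]

theorem mem_H_iff_T_mem {φ : ℕ → EndT} : φ ∈ H ↔ T φ ∈ H := by
  have h0 : T φ 0 = φ 0 := rfl
  have hs : ∀ k x, T φ (k + 1) x = φ k x * φ (k + 1) x := fun _ _ => rfl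
  rw [mem_H_iff, mem_H_iff, h0]
  refine and_congr_right fun hid => ?_
  have h1 : ∀ x, T φ 1 x = x * φ 1 x := fun x => by rw [hs, hid]; rfl
  have hx' : ∀ {N : ℕ} {x : Circle}, x ^ N = 1 → ∀ k : ℕ, (x ^ k) ^ N = 1 := fun hx k => by
    rw [← pow_mul, mul_comm, pow_mul, hx, one_pow]
  have hfac : ∀ (x : Circle) (k : ℕ), x ^ (k + 1).factorial = (x ^ (k + 1)) ^ k.factorial :=
    fun x k => by rw [← pow_mul, Nat.factorial_succ]
  constructor
  · intro h N hN m hm k hk x hx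
    have hm' : ∀ y : Circle, y ^ N = 1 → φ 1 y = y ^ (m - 1) := fun y hy => by
      have := hm y hy
      rw [h1] at this
      rw [zpow_sub_one, ← this, mul_comm y, mul_inv_cancel_right]
    obtain ⟨n, rfl⟩ : ∃ n, k = n + 1 := ⟨k - 1, by omega⟩
    have hn : φ n (x ^ (n + 1).factorial) = (x ^ (n + 1).factorial) ^ Ring.choose (m - 1) n := by
      rcases Nat.eq_zero_or_pos n with rfl | hn
      · rw [hid, Ring.choose_zero_right, zpow_one]; rfl
      · rw [hfac]; exact h N hN _ hm' n hn _ (hx' hx _)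
    have hp := Ring.choose_succ_succ (m - 1) n
    rw [sub_add_cancel] at hp
    rw [hs, hn, h N hN _ hm' _ hk x hx, ← zpow_add, hp]
  · intro h N hN m hm k hk
    have hm' : ∀ y : Circle, y ^ N = 1 → T φ 1 y = y ^ (m + 1) := fun y hy => by
      rw [h1, hm y hy, zpow_add_one, mul_comm]
    induction k, hk using Nat.le_induction with
    | base =>
      intro x hx
      simp only [Nat.factorial_one, pow_one, Ring.choose_one_right]
      exact hm x hx
    | succ k hk ih =>
      intro x hx
      have h2 := h N hN _ hm' (k + 1) (by omega) x hx
      have h3 := ih (x ^ (k + 1)) (hx' hx _)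
      rw [← hfac] at h3
      rw [hs, h3, Ring.choose_succ_succ, zpow_add] at h2
      exact mul_left_cancel h2

theorem isClosed_H : IsClosed H := by
  have key : H = {φ | φ 0 = MonoidHom.id Circle} ∩ ⋂ N ∈ {N : ℕ | 0 < N}, ⋃ m ∈ Finset.range N,
      {φ | (∀ y : Circle, y ^ N = 1 → φ 1 y = y ^ (m : ℤ)) ∧
        ∀ k : ℕ, 1 ≤ k → ∀ x : Circle, x ^ N = 1 →
        φ k (x ^ k.factorial) = (x ^ k.factorial) ^ (Ring.choose (m : ℤ) k)} := by
    ext φ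
    simp only [Set.mem_inter_iff, Set.mem_iInter, Set.mem_iUnion, Set.mem_ofPred_eq,
      Finset.mem_range, exists_prop]
    constructor
    · intro h
      refine ⟨h.1, fun N hN => ?_⟩
      obtain ⟨m, hmN, hm⟩ := exists_power (φ 1) N hN
      exact ⟨m, hmN, hm, (mem_H_iff.1 h).2 N hN m hm⟩
    · rintro ⟨hid, h⟩
      refine ⟨hid, fun k hk x hx => ?_⟩
      obtain ⟨N, hN, hx⟩ := mem_torsionT.1 hx
      obtain ⟨m, -, hm, h'⟩ := h N hN
      rw [h' k hk x hx, prod_stirling hm hx hk]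
  have hc : ∀ (k : ℕ) (x : Circle), Continuous fun φ : ℕ → EndT => φ k x := fun k x =>
    (continuous_eval x).comp (continuous_apply k)
  rw [key]
  refine (isClosed_eq (continuous_apply 0) continuous_const).inter ?_
  refine isClosed_biInter fun N _ => isClosed_biUnion_finset fun m _ => ?_
  simp only [Set.ofPred_and, Set.ofPred_forall]
  refine IsClosed.inter ?_ ?_
  · exact isClosed_iInter fun y => isClosed_iInter fun _ => isClosed_eq (hc _ _) continuous_const
  · exact isClosed_iInter fun k => isClosed_iInter fun _ => isClosed_iInter fun x =>
      isClosed_iInter fun _ => isClosed_eq (hc _ _) continuous_const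

instance : CompactSpace H := isCompact_iff_compactSpace.1 isClosed_H.isCompact

/-- The system `(𝓗, T)`: the restriction of `T` to `𝓗`. -/
noncomputable def TH : H ≃ₜ H := T.subtype fun _ => mem_H_iff_T_mem

end TopDyn

namespace TopDyn

open Filter Topology Finset
open scoped ComplexConjugate

/-! ### Averages of sequences and van der Corput's lemma -/

/-! The core is that every forward `T`-orbit in `𝓗` is dense. A neighbourhood of `ψ` constrains
finitely many values `φ_k(x)`, and these split into a torsion part and an equidistributing part. On
`M`-torsion `φ_1` is a power map `y ↦ y^m`, the relation defining `𝓗` then forces `φ_k` to act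
through `Ring.choose m k` on `k!`-th powers, and `T^n` replaces `m` by `m + n`; so along a
progression `a + Mn` the orbit of `φ` agrees exactly with `ψ` on given torsion
(`exists_forall_T_iterate_eq`). A product of values involving a non-torsion point at a positive
index becomes, after finitely many differences, a rotation of infinite order, so its averages vanish
by van der Corput (`isWeylSequence_pairing`, `IsWeylSequence.tendsto_average`). Comparison with Haar
measure turns these two facts into recurrence (`one_mem_closure_range_of_characters`), and
minimality follows.

The coordinates `φ ↦ φ_k(x)` are quasi-eigenfunctions separating points, so Stone–Weierstrass gives
quasi-discrete spectrum. For universality, the value of a quasi-eigenfunction of `(Y, t)` at `t^n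
y₀` is the pairing of `T^n (id, 1, 1, …)` with a fixed finite sequence in `𝕋`; hence the joint orbit
closure in `𝓗 × Y` is the graph of a map `𝓗 → Y` (`isFactorOf_TH`).

For uniqueness, factor maps `𝓗 → Y → 𝓗` compose to an endomorphism of `(𝓗, T)`. Endomorphisms are
triangular in the coordinates with identity diagonal, hence injective
(`IsSystemHom.injective_of_TH`), so `𝓗 → Y` is injective too. -/

/-- The average of the first `N` terms of a sequence. -/
noncomputable def average (v : ℕ → ℂ) (N : ℕ) : ℂ := (N : ℂ)⁻¹ * ∑ n ∈ range N, v n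

theorem average_finsetSum {ι : Type*} (s : Finset ι) (v : ι → ℕ → ℂ) (N : ℕ) :
    average (fun n => ∑ i ∈ s, v i n) N = ∑ i ∈ s, average (v i) N := by
  simp only [average, mul_sum]
  exact sum_comm

theorem average_const_mul (c : ℂ) (v : ℕ → ℂ) (N : ℕ) :
    average (fun n => c * v n) N = c * average v N := by
  simp only [average, ← mul_sum]
  ring

theorem average_add (v w : ℕ → ℂ) (N : ℕ) :
    average (fun n => v n + w n) N = average v N + average w N := by
  simp only [average, sum_add_distrib, mul_add]

theorem average_conj (v : ℕ → ℂ) (N : ℕ) :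
    average (fun n => conj (v n)) N = conj (average v N) := by
  simp [average]

theorem average_const (c : ℂ) {N : ℕ} (hN : N ≠ 0) : average (fun _ => c) N = c := by
  have : (N : ℂ) ≠ 0 := by exact_mod_cast hN
  simp [average, this]

theorem norm_average_le {v : ℕ → ℂ} {C : ℝ} (hC : 0 ≤ C) (hv : ∀ n, ‖v n‖ ≤ C) (N : ℕ) :
    ‖average v N‖ ≤ C := by
  rcases Nat.eq_zero_or_pos N with rfl | hN
  · simpa [average] using hC
  · have hN' : (0 : ℝ) < N := by exact_mod_cast hN
    rw [average, norm_mul, norm_inv, Complex.norm_natCast, inv_mul_le_iff₀ hN']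
    calc ‖∑ n ∈ range N, v n‖ ≤ ∑ n ∈ range N, ‖v n‖ := norm_sum_le _ _
      _ ≤ ∑ n ∈ range N, C := sum_le_sum fun n _ => hv n
      _ = N * C := by simp

theorem tendsto_average_shift_sub {v : ℕ → ℂ} (hv : ∀ n, ‖v n‖ ≤ 1) (h : ℕ) :
    Tendsto (fun N => average (fun n => v (n + h)) N - average v N) atTop (𝓝 0) := by
  induction h with
  | zero => simp
  | succ h ih =>
    have key : Tendsto (fun N => average (fun n => v (n + (h + 1))) N
        - average (fun n => v (n + h)) N) atTop (𝓝 0) := by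
      have h2 : Tendsto (fun N : ℕ => (2 : ℝ) / N) atTop (𝓝 0) :=
        tendsto_const_div_atTop_nhds_zero_nat 2
      refine squeeze_zero_norm (fun N => ?_) h2
      have e : average (fun n => v (n + (h + 1))) N - average (fun n => v (n + h)) N
          = (N : ℂ)⁻¹ * (v (N + h) - v (0 + h)) := by
        rw [average, average, ← mul_sub, ← sum_sub_distrib,
          ← sum_range_sub (fun n => v (n + h)) N]
        simp only [add_right_comm, add_assoc]
      rw [e, norm_mul, norm_inv, Complex.norm_natCast, div_eq_inv_mul]
      refine mul_le_mul_of_nonneg_left ?_ (by positivity)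
      calc ‖v (N + h) - v (0 + h)‖ ≤ ‖v (N + h)‖ + ‖v (0 + h)‖ := norm_sub_le _ _
        _ ≤ 2 := by linarith [hv (N + h), hv (0 + h)]
    simpa using key.add ih

theorem sq_norm_average_le (v : ℕ → ℂ) (N : ℕ) :
    ‖average v N‖ ^ 2 ≤ (N : ℝ)⁻¹ * ∑ n ∈ range N, ‖v n‖ ^ 2 := by
  rcases Nat.eq_zero_or_pos N with rfl | hN
  · simp [average]
  have hN' : (0 : ℝ) < N := by exact_mod_cast hN
  rw [average, norm_mul, mul_pow, norm_inv, Complex.norm_natCast]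
  have h1 : ‖∑ n ∈ range N, v n‖ ^ 2 ≤ N * ∑ n ∈ range N, ‖v n‖ ^ 2 := by
    calc ‖∑ n ∈ range N, v n‖ ^ 2 ≤ (∑ n ∈ range N, ‖v n‖) ^ 2 := by
          gcongr; exact norm_sum_le _ _
      _ ≤ N * ∑ n ∈ range N, ‖v n‖ ^ 2 := by
          simpa using sq_sum_le_card_mul_sum_sq (s := range N) (f := fun n => ‖v n‖)
  calc ((N : ℝ)⁻¹) ^ 2 * ‖∑ n ∈ range N, v n‖ ^ 2
      ≤ ((N : ℝ)⁻¹) ^ 2 * (N * ∑ n ∈ range N, ‖v n‖ ^ 2) := by gcongr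
    _ = _ := by field_simp

/-- Van der Corput's lemma for circle-valued sequences. -/
theorem tendsto_average_of_forall_shift_div {v : ℕ → Circle}
    (hv : ∀ h : ℕ, 0 < h → Tendsto (average fun n => ((v (n + h) / v n : Circle) : ℂ))
      atTop (𝓝 0)) :
    Tendsto (average fun n => (v n : ℂ)) atTop (𝓝 0) := by
  have hlt : ∀ i j : ℕ, j < i →
      Tendsto (average fun n => ((v (n + i) / v (n + j) : Circle) : ℂ)) atTop (𝓝 0) := by
    intro i j hij
    have h1 := tendsto_average_shift_sub
      (v := fun n => ((v (n + (i - j)) / v n : Circle) : ℂ)) (fun n => (Circle.norm_coe _).le) j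
    have h2 := h1.add (hv (i - j) (by omega))
    simp only [sub_add_cancel, add_zero] at h2
    refine h2.congr fun N => ?_
    congr 1; funext n
    rw [show n + j + (i - j) = n + i by omega]
  have hne : ∀ i j : ℕ, i ≠ j →
      Tendsto (average fun n => ((v (n + i) / v (n + j) : Circle) : ℂ)) atTop (𝓝 0) := by
    intro i j hij
    rcases lt_or_gt_of_ne hij with h | h
    · have h1 := (Complex.continuous_conj.tendsto 0).comp (hlt j i h)
      rw [map_zero] at h1
      refine h1.congr fun N => ?_
      rw [Function.comp_apply, ← average_conj]
      congr 1; funext n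
      rw [← Circle.coe_inv_eq_conj, inv_div]
    · exact hlt i j h
  -- Expanding the square, the off-diagonal correlations vanish in the limit and each of the `H`
  -- diagonal terms contributes 1.
  have hsq : ∀ H : ℕ, Tendsto (fun N : ℕ => (N : ℝ)⁻¹ *
      ∑ n ∈ range N, ‖∑ i ∈ range H, (v (n + i) : ℂ)‖ ^ 2) atTop (𝓝 (H : ℝ)) := by
    intro H
    have h1 : Tendsto (fun N => ∑ i ∈ range H, ∑ j ∈ range H,
        average (fun n => ((v (n + i) / v (n + j) : Circle) : ℂ)) N) atTop
        (𝓝 (∑ i ∈ range H, ∑ j ∈ range H, if i = j then (1 : ℂ) else 0)) := by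
      refine tendsto_finsetSum _ fun i _ => tendsto_finsetSum _ fun j _ => ?_
      by_cases hij : i = j
      · subst hij
        simp only [div_self', Circle.coe_one, if_true]
        refine tendsto_const_nhds.congr' ?_
        filter_upwards [eventually_ne_atTop 0] with N hN
        rw [average_const 1 hN]
      · simpa [hij] using hne i j hij
    have h2 : (∑ i ∈ range H, ∑ j ∈ range H, if i = j then (1 : ℂ) else 0) = H := by
      simp +contextual [Finset.sum_ite_eq]
    rw [h2] at h1
    have h3 := (Complex.continuous_re.tendsto _).comp h1
    rw [Complex.natCast_re] at h3
    refine h3.congr fun N => ?_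
    have h4 : (((N : ℝ)⁻¹ * ∑ n ∈ range N, ‖∑ i ∈ range H, (v (n + i) : ℂ)‖ ^ 2 : ℝ) : ℂ)
        = ∑ i ∈ range H, ∑ j ∈ range H,
          average (fun n => ((v (n + i) / v (n + j) : Circle) : ℂ)) N := by
      simp only [← average_finsetSum]
      rw [average]
      push_cast
      congr 1
      refine sum_congr rfl fun n _ => ?_
      rw [← Complex.mul_conj', map_sum, sum_mul_sum]
      refine sum_congr rfl fun i _ => sum_congr rfl fun j _ => ?_
      rw [div_eq_mul_inv, ← Circle.coe_inv_eq_conj]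
      simp
    rw [Function.comp_apply, ← h4, Complex.ofReal_re]
  have hlin : ∀ H : ℕ, Tendsto (fun N => average (fun n => ∑ i ∈ range H, (v (n + i) : ℂ)) N
      - H * average (fun n => (v n : ℂ)) N) atTop (𝓝 0) := by
    intro H
    have h1 : Tendsto (fun N => ∑ i ∈ range H, (average (fun n => (v (n + i) : ℂ)) N
        - average (fun n => (v n : ℂ)) N)) atTop (𝓝 (∑ i ∈ range H, 0)) :=
      tendsto_finsetSum _ fun i _ =>
        tendsto_average_shift_sub (v := fun n => (v n : ℂ)) (fun n => (Circle.norm_coe _).le) i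
    simp only [sum_const_zero] at h1
    refine h1.congr fun N => ?_
    rw [average_finsetSum, sum_sub_distrib]
    simp
  rw [Metric.tendsto_atTop']
  intro ε hε
  -- With windows of length `m²`, eventually `m²‖a‖ ≤ ‖s‖ + 1 ≤ m + 2 ≤ 3m`, so `‖a‖ ≤ 3/m < ε`.
  obtain ⟨m, hm⟩ := exists_nat_gt (3 / ε)
  have hm0 : (0 : ℝ) < m := lt_trans (by positivity) hm
  have hm1 : (1 : ℝ) ≤ m := by exact_mod_cast Nat.one_le_iff_ne_zero.2 (by rintro rfl; simp at hm0)
  have e1 := (hsq (m ^ 2)).eventually_lt_const (lt_add_one _)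
  have e2 := (hlin (m ^ 2)).norm.eventually_lt_const (u := 1) (by simp)
  obtain ⟨N₀, hN₀⟩ := eventually_atTop.1 (e1.and e2)
  refine ⟨N₀, fun N hN => ?_⟩
  obtain ⟨h1, h2⟩ := hN₀ N hN.le
  have h3 := sq_norm_average_le (fun n => ∑ i ∈ range (m ^ 2), (v (n + i) : ℂ)) N
  set s := average (fun n => ∑ i ∈ range (m ^ 2), (v (n + i) : ℂ)) N
  set a := average (fun n => (v n : ℂ)) N
  have h4 : ‖s‖ ≤ m + 1 := by
    push_cast at h1
    refine abs_le_of_sq_le_sq' (a := ‖s‖) (b := m + 1) ?_ (by positivity) |>.2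
    nlinarith
  have h5 : (m : ℝ) ^ 2 * ‖a‖ ≤ m + 2 := by
    have : ‖((m ^ 2 : ℕ) : ℂ) * a‖ ≤ ‖s‖ + ‖s - ((m ^ 2 : ℕ) : ℂ) * a‖ := by
      have := norm_sub_le s (s - ((m ^ 2 : ℕ) : ℂ) * a)
      rwa [sub_sub_cancel] at this
    rw [norm_mul, Complex.norm_natCast] at this
    push_cast at this h2
    linarith
  rw [dist_zero_right]
  have h6 : (m : ℝ) * ‖a‖ ≤ 3 := by
    have : (m : ℝ) * (m * ‖a‖) ≤ m * 3 := by nlinarith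
    exact le_of_mul_le_mul_left this hm0
  rw [div_lt_iff₀ hε] at hm
  by_contra! hcon
  nlinarith

/-! ### Sequences of Weyl type -/

/-- Circle-valued sequences that become, after finitely many differences, an irrational rotation
along the multiples of some period. -/
inductive IsWeylSequence : (ℕ → Circle) → Prop
  | base (v : ℕ → Circle) (M : ℕ) (c : Circle) (hM : 0 < M) (hc : ¬ IsOfFinOrder c)
      (h : ∀ n, v (n + M) = c * v n) : IsWeylSequence v
  | step (v : ℕ → Circle) (h : ∀ h : ℕ, 0 < h → IsWeylSequence fun n => v (n + h) / v n) :
      IsWeylSequence v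

theorem IsWeylSequence.const_mul {v : ℕ → Circle} (hv : IsWeylSequence v) (b : Circle) :
    IsWeylSequence fun n => b * v n := by
  induction hv with
  | base v M c hM hc h => exact .base _ M c hM hc fun n => by rw [h, mul_left_comm]
  | step v h _ => exact .step _ fun k hk => by simpa only [mul_div_mul_left_eq_div] using h k hk

/-- Sampling along a progression replaces the rotation `c` by `c ^ M`, still of infinite order. This
stability is why the base case asks for infinite order and not just `c ≠ 1`; it allows the orbit to
be restricted to times at which its torsion part is prescribed. -/
theorem IsWeylSequence.comp_add_mul {v : ℕ → Circle} (hv : IsWeylSequence v) (a : ℕ) {M : ℕ}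
    (hM : 0 < M) : IsWeylSequence fun n => v (a + M * n) := by
  induction hv with
  | base v M' c hM' hc h =>
    have hit : ∀ k n, v (n + M' * k) = c ^ k * v n := by
      intro k
      induction k with
      | zero => simp
      | succ k ih => intro n; rw [Nat.mul_succ, ← add_assoc, h, ih, pow_succ', mul_assoc]
    refine .base _ M' (c ^ M) hM' (fun hcM => hc (hcM.of_pow hM.ne')) fun n => ?_
    rw [← hit]
    congr 1
    ring
  | step v _ ih =>
    refine .step _ fun k hk => ?_
    have := ih (M * k) (Nat.mul_pos hM hk)
    simpa only [mul_add, add_assoc] using this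

/-- A shift by `M` multiplies the average by `c` yet changes it by `o(1)`, so `c - 1` times the
average tends to 0. -/
theorem tendsto_average_of_shift_eq_mul {v : ℕ → Circle} {M : ℕ} {c : Circle} (hc : c ≠ 1)
    (h : ∀ n, v (n + M) = c * v n) : Tendsto (average fun n => (v n : ℂ)) atTop (𝓝 0) := by
  have h1 := tendsto_average_shift_sub (v := fun n => (v n : ℂ)) (fun n => (Circle.norm_coe _).le) M
  have hc' : (c : ℂ) - 1 ≠ 0 := sub_ne_zero.2 fun hc' => hc (Circle.coe_injective (by simpa using hc'))
  have h2 := h1.const_mul ((c : ℂ) - 1)⁻¹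
  rw [mul_zero] at h2
  refine h2.congr fun N => ?_
  simp only [h, Circle.coe_mul, average_const_mul]
  field_simp

theorem IsWeylSequence.tendsto_average {v : ℕ → Circle} (hv : IsWeylSequence v) :
    Tendsto (average fun n => (v n : ℂ)) atTop (𝓝 0) := by
  induction hv with
  | base v M c _ hc h =>
    exact tendsto_average_of_shift_eq_mul (fun h1 => hc (by rw [h1]; exact IsOfFinOrder.one)) h
  | step v _ ih => exact tendsto_average_of_forall_shift_div ih

/-! ### Spans of characters -/

section Characters

variable {X : Type*} [TopologicalSpace X]

/-- A circle-valued continuous function, viewed as a complex-valued one. -/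
noncomputable def toComplex (g : C(X, Circle)) : C(X, ℂ) := ⟨fun x => (g x : ℂ), by fun_prop⟩

/-- The span of a point-separating group of circle-valued functions is dense. -/
theorem dense_span_of_separating [CompactSpace X] (S : Set C(X, Circle)) (h1 : 1 ∈ S)
    (hmul : ∀ f ∈ S, ∀ g ∈ S, f * g ∈ S) (hinv : ∀ f ∈ S, f⁻¹ ∈ S)
    (hsep : ∀ x y : X, x ≠ y → ∃ f ∈ S, f x ≠ f y) :
    Dense (Submodule.span ℂ (toComplex '' S) : Set C(X, ℂ)) := by
  set V := Submodule.span ℂ (toComplex '' S) with hV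
  have hmem : ∀ f ∈ S, toComplex f ∈ V := fun f hf => Submodule.subset_span ⟨f, hf, rfl⟩
  have hmulV : ∀ F ∈ V, ∀ G ∈ V, F * G ∈ V := by
    intro F hF G hG
    induction hF using Submodule.span_induction with
    | mem F hF =>
      obtain ⟨f, hf, rfl⟩ := hF
      induction hG using Submodule.span_induction with
      | mem G hG =>
        obtain ⟨g, hg, rfl⟩ := hG
        have : toComplex f * toComplex g = toComplex (f * g) := by ext x; simp [toComplex]
        rw [this]
        exact hmem _ (hmul f hf g hg)
      | zero => simp
      | add G G' _ _ h h' => rw [mul_add]; exact V.add_mem h h'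
      | smul c G _ h => rw [mul_smul_comm]; exact V.smul_mem c h
    | zero => simp
    | add F F' _ _ h h' => rw [add_mul]; exact V.add_mem h h'
    | smul c F _ h => rw [smul_mul_assoc]; exact V.smul_mem c h
  have hone : (1 : C(X, ℂ)) ∈ V := by
    have : toComplex (1 : C(X, Circle)) = 1 := by ext x; simp [toComplex]
    exact this ▸ hmem 1 h1
  have hstar : ∀ F ∈ V, star F ∈ V := by
    intro F hF
    induction hF using Submodule.span_induction with
    | mem F hF =>
      obtain ⟨f, hf, rfl⟩ := hF
      have : star (toComplex f) = toComplex f⁻¹ := by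
        ext x; simp [toComplex, ← Circle.coe_inv_eq_conj]
      rw [this]
      exact hmem _ (hinv f hf)
    | zero => simp
    | add F F' _ _ h h' => rw [star_add]; exact V.add_mem h h'
    | smul c F _ h => rw [star_smul]; exact V.smul_mem _ h
  -- The group structure of `S` makes the span a unital star subalgebra, to which Stone–Weierstrass
  -- applies.
  let A : StarSubalgebra ℂ C(X, ℂ) :=
    { carrier := V
      mul_mem' := fun hF hG => hmulV _ hF _ hG
      add_mem' := V.add_mem
      algebraMap_mem' := fun c => by
        rw [Algebra.algebraMap_eq_smul_one]; exact V.smul_mem c hone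
      star_mem' := fun hF => hstar _ hF }
  have hA : A.SeparatesPoints := by
    intro x y hxy
    obtain ⟨f, hf, hne⟩ := hsep x y hxy
    exact ⟨toComplex f, ⟨toComplex f, hmem f hf, rfl⟩, fun h => hne (Circle.coe_injective h)⟩
  have := ContinuousMap.starSubalgebra_topologicalClosure_eq_top_of_separatesPoints A hA
  rw [dense_iff_closure_eq]
  have h2 : closure (A : Set C(X, ℂ)) = Set.univ := by
    rw [← StarSubalgebra.topologicalClosure_coe, this]; rfl
  exact h2

end Characters

/-! ### A recurrence criterion in compact abelian groups -/

section Recurrence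

open MeasureTheory

variable {P : Type*} [CommGroup P] [TopologicalSpace P] [IsTopologicalGroup P] [CompactSpace P]
  [T2Space P]

/-- If the averages of a sequence along each character of a separating group vanish, unless the
character is trivial on the sequence, then the sequence accumulates at `1`. -/
theorem one_mem_closure_range_of_characters (C : Subgroup (P →ₜ* Circle))
    (hsep : ∀ x y : P, x ≠ y → ∃ χ ∈ C, χ x ≠ χ y) (u : ℕ → P)
    (hu : ∀ χ ∈ C, (∀ n, χ (u n) = 1) ∨
      Tendsto (average fun n => (χ (u n) : ℂ)) atTop (𝓝 0)) :
    (1 : P) ∈ closure (Set.range u) := by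
  -- The averages along `u` will be shown to converge to integration against Haar measure of the
  -- closed subgroup generated by `u`.
  set G : Subgroup P := (Subgroup.closure (Set.range u)).topologicalClosure with hG
  have hGc : IsClosed (G : Set P) := Subgroup.isClosed_topologicalClosure _
  have huG : ∀ n, u n ∈ G := fun n =>
    Subgroup.le_topologicalClosure _ (Subgroup.subset_closure ⟨n, rfl⟩)
  have : CompactSpace G := isCompact_iff_compactSpace.1 hGc.isCompact
  let _ : MeasurableSpace G := borel G
  have : BorelSpace G := ⟨rfl⟩
  let μ : Measure G := Measure.haarMeasure ⊤
  have hμ : IsProbabilityMeasure μ :=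
    ⟨by simpa using Measure.haarMeasure_self (K₀ := (⊤ : TopologicalSpace.PositiveCompacts G))⟩
  have hint : ∀ F : C(P, ℂ), Integrable (fun g : G => F g) μ := fun F =>
    (F.continuous.comp continuous_subtype_val).integrable_of_hasCompactSupport
      (HasCompactSupport.of_compactSpace _)
  let W : Set C(P, ℂ) := {F | Tendsto (average fun n => F (u n)) atTop (𝓝 (∫ g : G, F g ∂μ))}
  have hchar : ∀ χ ∈ C, toComplex (χ : C(P, Circle)) ∈ W := by
    intro χ hχ
    change Tendsto (average fun n => (χ (u n) : ℂ)) atTop (𝓝 (∫ g : G, (χ g : ℂ) ∂μ))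
    by_cases h1 : ∀ n, χ (u n) = 1
    · have hker : ∀ g ∈ G, χ g = 1 := by
        have hle : G ≤ (χ : P →* Circle).ker := by
          refine Subgroup.topologicalClosure_minimal _ ?_ ?_
          · rw [Subgroup.closure_le]
            rintro _ ⟨n, rfl⟩
            exact h1 n
          · exact isClosed_singleton.preimage χ.continuous_toFun
        exact fun g hg => hle hg
      have h2 : (∫ g : G, (χ g : ℂ) ∂μ) = 1 := by
        rw [integral_congr_ae (g := fun _ => (1 : ℂ)) (ae_of_all _ fun g => by
          simp [hker g g.2])]
        simp
      rw [h2]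
      refine tendsto_const_nhds.congr' ?_
      filter_upwards [eventually_ne_atTop 0] with N hN
      simp only [h1, Circle.coe_one]
      rw [average_const 1 hN]
    · have h2 : (∫ g : G, (χ g : ℂ) ∂μ) = 0 := by
        push Not at h1
        obtain ⟨n, hn⟩ := h1
        -- Invariance under translation by `u n` multiplies the integral by `χ (u n) ≠ 1`, so it is
        -- 0.
        have h3 := integral_mul_left_eq_self (μ := μ) (fun g : G => (χ g : ℂ)) ⟨u n, huG n⟩
        simp only [Subgroup.coe_mul, map_mul, Circle.coe_mul] at h3
        rw [integral_const_mul] at h3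
        have h4 : ((χ (u n) : ℂ) - 1) * ∫ g : G, (χ g : ℂ) ∂μ = 0 := by
          rw [sub_mul, h3]; simp
        refine (mul_eq_zero.1 h4).resolve_left (sub_ne_zero.2 fun h5 => hn ?_)
        exact Circle.coe_injective (by simpa using h5)
      rw [h2]
      exact (hu χ hχ).resolve_left h1
  have hspan : ∀ F ∈ Submodule.span ℂ
      (toComplex '' ((fun χ : P →ₜ* Circle => (χ : C(P, Circle))) '' C)), F ∈ W := by
    intro F hF
    induction hF using Submodule.span_induction with
    | mem F hF =>
      obtain ⟨_, ⟨χ, hχ, rfl⟩, rfl⟩ := hF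
      exact hchar χ hχ
    | zero =>
      change Tendsto (average fun n => 0) atTop (𝓝 (∫ g : G, 0 ∂μ))
      have : (average fun _ => 0) = fun _ => 0 := by funext N; simp [average]
      simp [this]
    | add F F' _ _ h h' =>
      change Tendsto (average fun n => F (u n) + F' (u n)) atTop (𝓝 (∫ g : G, F g + F' g ∂μ))
      rw [integral_add (hint F) (hint F')]
      exact (Tendsto.add h h').congr fun N => (average_add _ _ N).symm
    | smul c F _ h =>
      change Tendsto (average fun n => c * F (u n)) atTop (𝓝 (∫ g : G, c * F g ∂μ))
      rw [integral_const_mul]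
      exact (Tendsto.const_mul c h).congr fun N => (average_const_mul _ _ N).symm
  have hdense := dense_span_of_separating
    ((fun χ : P →ₜ* Circle => (χ : C(P, Circle))) '' C) ⟨1, C.one_mem, rfl⟩
    (by rintro _ ⟨χ, hχ, rfl⟩ _ ⟨χ', hχ', rfl⟩; exact ⟨χ * χ', C.mul_mem hχ hχ', rfl⟩)
    (by rintro _ ⟨χ, hχ, rfl⟩; exact ⟨χ⁻¹, C.inv_mem hχ, rfl⟩)
    (fun x y hxy => by
      obtain ⟨χ, hχ, hne⟩ := hsep x y hxy
      exact ⟨_, ⟨χ, hχ, rfl⟩, hne⟩)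
  have hall : ∀ F : C(P, ℂ), F ∈ W := by
    intro F
    change Tendsto _ _ _
    rw [Metric.tendsto_atTop']
    intro ε hε
    obtain ⟨F', hF', hd⟩ := Metric.dense_iff.1 hdense F (ε / 3) (by positivity)
    have hpt : ∀ x, ‖F x - F' x‖ ≤ ε / 3 := fun x => by
      rw [← dist_eq_norm, dist_comm]
      exact (ContinuousMap.dist_apply_le_dist x).trans (Metric.mem_ball.1 hF').le
    obtain ⟨N₀, hN₀⟩ := Metric.tendsto_atTop'.1 (hspan F' hd) (ε / 3) (by positivity)
    refine ⟨N₀, fun N hN => ?_⟩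
    have h1 := hN₀ N hN
    have h2 : ‖average (fun n => F (u n)) N - average (fun n => F' (u n)) N‖ ≤ ε / 3 := by
      have := norm_average_le (v := fun n => F (u n) - F' (u n)) (by positivity)
        (fun n => hpt (u n)) N
      have e := average_add (fun n => F (u n) - F' (u n)) (fun n => F' (u n)) N
      simp only [sub_add_cancel] at e
      rwa [e, add_sub_cancel_right]
    have h3 : ‖(∫ g : G, F g ∂μ) - ∫ g : G, F' g ∂μ‖ ≤ ε / 3 := by
      rw [← integral_sub (hint F) (hint F')]
      have := norm_integral_le_of_norm_le_const (μ := μ) (f := fun g : G => F g - F' g)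
        (ae_of_all _ fun g => hpt g)
      simpa using this
    rw [dist_eq_norm] at h1 ⊢
    have e : average (fun n => F (u n)) N - ∫ g : G, F g ∂μ
        = (average (fun n => F (u n)) N - average (fun n => F' (u n)) N)
          + (average (fun n => F' (u n)) N - ∫ g : G, F' g ∂μ)
          - ((∫ g : G, F g ∂μ) - ∫ g : G, F' g ∂μ) := by ring
    rw [e]
    refine (norm_sub_le _ _).trans_lt ?_
    have := norm_add_le (average (fun n => F (u n)) N - average (fun n => F' (u n)) N)
      (average (fun n => F' (u n)) N - ∫ g : G, F' g ∂μ)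
    linarith
  by_contra hcl
  -- A Urysohn function vanishing along `u` has zero averages, but being nonnegative and equal to 1
  -- at the identity it has positive Haar integral.
  obtain ⟨f, hf0, hf1, hf⟩ := exists_continuous_zero_one_of_isClosed
    (s := closure (Set.range u)) (t := {(1 : P)}) isClosed_closure isClosed_singleton
    (Set.disjoint_singleton_right.2 hcl)
  have h1 : Tendsto (average fun n => ((f (u n) : ℝ) : ℂ)) atTop
      (𝓝 (∫ g : G, ((f g : ℝ) : ℂ) ∂μ)) := hall ⟨fun x => (f x : ℂ), by fun_prop⟩
  have h2 : (average fun n => ((f (u n) : ℝ) : ℂ)) = fun _ => 0 := by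
    funext N
    have : ∀ n, f (u n) = 0 := fun n => hf0 (subset_closure ⟨n, rfl⟩)
    simp [average, this]
  rw [h2, integral_complex_ofReal] at h1
  have h3 := tendsto_nhds_unique h1 tendsto_const_nhds
  have h4 : 0 < ∫ g : G, f g ∂μ :=
    (f.continuous.comp continuous_subtype_val).integral_pos_of_hasCompactSupport_nonneg_nonzero
      (HasCompactSupport.of_compactSpace _) (fun g => (hf g).1) (x := 1)
      (by simp [hf1 (Set.mem_singleton (1 : P))])
  exact h4.ne' (by exact_mod_cast h3)

end Recurrence

/-! ### The pairing of `H(𝕋)^ℕ` with finitely supported sequences in `𝕋` -/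

/-- The operator `(y₀, y₁, …) ↦ (y₀ y₁, y₁ y₂, …)`, dual to `T`. -/
noncomputable def dualShift : (ℕ → Circle) →* (ℕ → Circle) where
  toFun y l := y l * y (l + 1)
  map_one' := by funext l; simp
  map_mul' y z := by funext l; simp [mul_mul_mul_comm]

@[simp] theorem dualShift_apply (y : ℕ → Circle) (l : ℕ) : dualShift y l = y l * y (l + 1) := rfl

/-- The pairing `∏_{k ≤ K} φ_k (y_k)`. -/
noncomputable def pairing (K : ℕ) (φ : ℕ → EndT) (y : ℕ → Circle) : Circle :=
  ∏ k ∈ range (K + 1), φ k (y k)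

theorem pairing_mul_right (K : ℕ) (φ : ℕ → EndT) (y z : ℕ → Circle) :
    pairing K φ (y * z) = pairing K φ y * pairing K φ z := by
  simp [pairing, prod_mul_distrib]

theorem pairing_inv_right (K : ℕ) (φ : ℕ → EndT) (y : ℕ → Circle) :
    pairing K φ y⁻¹ = (pairing K φ y)⁻¹ := by
  simp [pairing]

theorem pairing_div_right (K : ℕ) (φ : ℕ → EndT) (y z : ℕ → Circle) :
    pairing K φ (y / z) = pairing K φ y / pairing K φ z := by
  rw [div_eq_mul_inv, pairing_mul_right, pairing_inv_right, div_eq_mul_inv]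

theorem pairing_mulSingle {K k : ℕ} (hk : k ≤ K) (φ : ℕ → EndT) (x : Circle) :
    pairing K φ (Pi.mulSingle k x) = φ k x := by
  rw [pairing, prod_eq_single_of_mem k (mem_range.2 (by omega))]
  · simp
  · intro b _ hb
    simp [Pi.mulSingle_eq_of_ne hb]

theorem continuous_pairing (K : ℕ) (y : ℕ → Circle) :
    Continuous fun φ : ℕ → EndT => pairing K φ y :=
  continuous_finsetProd _ fun k _ => (continuous_eval (y k)).comp (continuous_apply k)

/-- Summation by parts: the factors `φ_k(y_{k+1})` are regrouped with `φ_k(y_k)`. The support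
condition kills the boundary factor `φ_K(y_{K+1})`. -/
theorem pairing_T {K : ℕ} (φ : ℕ → EndT) {y : ℕ → Circle} (hy : ∀ l, K < l → y l = 1) :
    pairing K (T φ) y = pairing K φ (dualShift y) := by
  have h0 : T φ 0 (y 0) = φ 0 (y 0) := rfl
  have hs : ∀ k, T φ (k + 1) (y (k + 1)) = φ k (y (k + 1)) * φ (k + 1) (y (k + 1)) :=
    fun _ => rfl
  simp only [pairing, dualShift_apply, map_mul, prod_mul_distrib]
  rw [prod_range_succ', h0, prod_congr rfl fun k _ => hs k, prod_mul_distrib,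
    prod_range_succ' (fun k => φ k (y k)), prod_range_succ (fun k => φ k (y (k + 1))),
    hy (K + 1) (by omega), map_one, mul_one, mul_assoc, mul_comm]

theorem dualShift_iterate_eq_one {K : ℕ} {y : ℕ → Circle} (hy : ∀ l, K < l → y l = 1) (n : ℕ) :
    ∀ l, K < l → dualShift^[n] y l = 1 := by
  induction n with
  | zero => exact hy
  | succ n ih =>
    intro l hl
    rw [Function.iterate_succ_apply', dualShift_apply, ih l hl, ih _ (by omega), one_mul]

theorem pairing_T_iterate {K : ℕ} (φ : ℕ → EndT) {y : ℕ → Circle} (hy : ∀ l, K < l → y l = 1)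
    (n : ℕ) : pairing K (T^[n] φ) y = pairing K φ (dualShift^[n] y) := by
  induction n generalizing φ with
  | zero => rfl
  | succ n ih =>
    rw [Function.iterate_succ_apply, ih, pairing_T _ (dualShift_iterate_eq_one hy n),
      Function.iterate_succ_apply']

theorem T_iterate_zero (φ : ℕ → EndT) (n : ℕ) : (T^[n] φ) 0 = φ 0 := by
  induction n with
  | zero => rfl
  | succ n ih => rw [Function.iterate_succ_apply', ← ih]; rfl

theorem T_iterate_one_apply {φ : ℕ → EndT} (h0 : φ 0 = MonoidHom.id Circle) (n : ℕ) (x : Circle) :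
    (T^[n] φ) 1 x = x ^ n * φ 1 x := by
  induction n with
  | zero => simp
  | succ n ih =>
    have : T (T^[n] φ) 1 x = (T^[n] φ) 0 x * (T^[n] φ) 1 x := rfl
    rw [Function.iterate_succ_apply', this, ih, T_iterate_zero, h0, pow_succ', mul_assoc]
    rfl

/-- Written additively, `dualShift` is the identity plus the left shift, so Pascal's rule gives a
binomial expansion. -/
theorem dualShift_iterate_apply (y : ℕ → Circle) (n l : ℕ) :
    dualShift^[n] y l = ∏ j ∈ range (n + 1), y (l + j) ^ n.choose j := by
  induction n generalizing l with
  | zero => simp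
  | succ n ih =>
    rw [Function.iterate_succ_apply', dualShift_apply, ih, ih, prod_range_succ' _ (n + 1),
      prod_range_succ' _ n]
    simp only [Nat.choose_succ_succ, pow_add, prod_mul_distrib]
    rw [prod_range_succ (fun j => y (l + (j + 1)) ^ n.choose (j + 1))]
    simp only [Nat.choose_succ_self, pow_zero, mul_one, Nat.choose_zero_right, add_zero]
    have : ∀ j, l + 1 + j = l + (j + 1) := fun j => by omega
    simp only [this]
    rw [mul_right_comm, mul_comm, mul_assoc, mul_comm]
    simp only [mul_left_comm, mul_comm]

/-! ### Orbits of `T` along characters are Weyl sequences -/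

/-- Cancel `j`, a divisor of `K!`, in `j · C(n, j) = n · C(n - 1, j - 1)` with `n = N · K!`. -/
theorem dvd_choose_mul_factorial {N K j : ℕ} (hj : 0 < j) (hjK : j ≤ K) :
    N ∣ (N * K.factorial).choose j := by
  obtain ⟨i, rfl⟩ : ∃ i, j = i + 1 := ⟨j - 1, by omega⟩
  obtain ⟨c, hc⟩ := Nat.dvd_factorial hj hjK
  rcases Nat.eq_zero_or_pos N with rfl | hN
  · simp
  have hpos : 0 < N * K.factorial := Nat.mul_pos hN K.factorial_pos
  obtain ⟨m, hm⟩ : ∃ m, N * K.factorial = m + 1 := ⟨_, (Nat.succ_pred_eq_of_pos hpos).symm⟩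
  have h := Nat.add_one_mul_choose_eq m i
  rw [← hm, hc] at h
  refine ⟨c * m.choose i, Nat.eq_of_mul_eq_mul_right hj ?_⟩
  rw [hc, ← h]
  ring

/-- If all entries of `y` beyond the first two are torsion, then some iterate of `dualShift`
changes at most the first entry of `y`. -/
theorem exists_dualShift_iterate_eq {K : ℕ} {y : ℕ → Circle} (hy : ∀ l, K < l → y l = 1)
    (htor : ∀ l, 1 < l → IsOfFinOrder (y l)) :
    ∃ h : ℕ, 0 < h ∧ ∀ l, 0 < l → dualShift^[h] y l = y l := by
  set N := ∏ l ∈ Icc 2 K, orderOf (y l) with hN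
  have hN0 : 0 < N := prod_pos fun l hl => (htor l (by simp at hl; omega)).orderOf_pos
  have hyN : ∀ l, 1 < l → y l ^ N = 1 := by
    intro l hl
    rcases lt_or_ge K l with h | h
    · rw [hy l h, one_pow]
    · exact orderOf_dvd_iff_pow_eq_one.1 (dvd_prod_of_mem _ (by simp; omega))
  -- At this time every binomial exponent with `1 ≤ j ≤ K` is a multiple of `N`, hence kills the
  -- entries `y (l + j)`, which are torsion because `l + j > 1`.
  refine ⟨N * K.factorial, Nat.mul_pos hN0 K.factorial_pos, fun l hl => ?_⟩
  rw [dualShift_iterate_apply, prod_range_succ']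
  simp only [Nat.choose_zero_right, pow_one, add_zero]
  rw [prod_eq_one, one_mul]
  intro j _
  rcases lt_or_ge K (l + (j + 1)) with h | h
  · rw [hy _ h, one_pow]
  · obtain ⟨c, hc⟩ := dvd_choose_mul_factorial (N := N) (K := K) (j := j + 1) (by omega) (by omega)
    rw [hc, pow_mul, hyN _ (by omega), one_pow]

/-- Modulo `S` all entries beyond `k` are trivial, so the entries from `k` on are fixed. -/
theorem dualShift_iterate_div_mem {S : Subgroup Circle} {y : ℕ → Circle} {k : ℕ}
    (hS : ∀ l, k < l → y l ∈ S) (n : ℕ) {l : ℕ} (hl : k ≤ l) : dualShift^[n] y l / y l ∈ S := by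
  induction n generalizing l with
  | zero => simp
  | succ n ih =>
    rw [Function.iterate_succ_apply', dualShift_apply, mul_div_right_comm]
    have h1 := S.mul_mem (ih (l := l + 1) (by omega)) (hS (l + 1) (by omega))
    rw [div_mul_cancel] at h1
    exact S.mul_mem (ih hl) h1

/-- Modulo `S` the entry at `k + 1` is fixed, and each application multiplies the entry at `k` by
it. -/
theorem dualShift_iterate_div_pow_mem {S : Subgroup Circle} {y : ℕ → Circle} {k : ℕ}
    (hS : ∀ l, k + 1 < l → y l ∈ S) (n : ℕ) :
    dualShift^[n] y k / y k / y (k + 1) ^ n ∈ S := by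
  induction n with
  | zero => simp
  | succ n ih =>
    have h1 := S.mul_mem ih (dualShift_iterate_div_mem hS n le_rfl)
    rw [Function.iterate_succ_apply', dualShift_apply, pow_succ]
    convert h1 using 1
    simp only [div_eq_mul_inv, mul_inv_rev]
    simp only [mul_assoc, mul_left_comm, mul_comm]

/-- Differencing with step `h` replaces `y` by `dualShift^[h] y / y`, whose last non-torsion index
drops from `k + 1` to `k`: modulo torsion, the entry there is `y (k + 1) ^ h`. When only index 1
remains, a suitable `h` makes this quotient trivial except at index 0, where `φ_0 = id` turns it
into a constant rotation. -/
theorem isWeylSequence_pairing_aux {φ : ℕ → EndT} (h0 : φ 0 = MonoidHom.id Circle) {K : ℕ}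
    (k : ℕ) (y : ℕ → Circle) (hy : ∀ l, K < l → y l = 1) (hk : ¬ IsOfFinOrder (y (k + 1)))
    (htor : ∀ l, k + 1 < l → IsOfFinOrder (y l)) :
    IsWeylSequence fun n => pairing K (T^[n] φ) y := by
  have hadd : ∀ y : ℕ → Circle, (∀ l, K < l → y l = 1) → ∀ h n,
      pairing K (T^[n + h] φ) y = pairing K (T^[n] φ) (dualShift^[h] y) := by
    intro y hy h n
    rw [add_comm, Function.iterate_add_apply, pairing_T_iterate _ hy]
  have hnon : ∀ (k : ℕ) (y : ℕ → Circle), ¬ IsOfFinOrder (y (k + 1)) →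
      (∀ l, k + 1 < l → IsOfFinOrder (y l)) → ∀ h : ℕ, 0 < h →
      ¬ IsOfFinOrder (dualShift^[h] y k / y k) := by
    intro k y hk htor h hh hfin
    have h1 := dualShift_iterate_div_pow_mem (S := CommGroup.torsion Circle) htor h
    have h2 : y (k + 1) ^ h ∈ CommGroup.torsion Circle := by
      have := (CommGroup.torsion Circle).div_mem hfin h1
      rwa [div_div_cancel] at this
    exact hk (IsOfFinOrder.of_pow h2 hh.ne')
  induction k generalizing y with
  | zero =>
    obtain ⟨h, hh, heq⟩ := exists_dualShift_iterate_eq hy htor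
    refine .base _ h _ hh (hnon 0 y hk htor h hh) fun n => ?_
    rw [hadd y hy, ← div_eq_iff_eq_mul, ← pairing_div_right, pairing, prod_range_succ', prod_eq_one]
    · rw [one_mul, T_iterate_zero, h0]
      rfl
    · intro l _
      rw [Pi.div_apply, heq _ (by omega), div_self', map_one]
  | succ k ih =>
    refine .step _ fun h hh => ?_
    have := ih (dualShift^[h] y / y)
      (fun l hl => by rw [Pi.div_apply, dualShift_iterate_eq_one hy h l hl, hy l hl, div_one])
      (hnon _ y hk htor h hh)
      (fun l hl => dualShift_iterate_div_mem (S := CommGroup.torsion Circle) htor h (by omega))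
    simpa only [pairing_div_right, ← hadd y hy] using this

/-- The last non-torsion index reduces this to the previous lemma. Positivity of `k` matters: the
entry at 0 contributes only a constant factor along the orbit. -/
theorem isWeylSequence_pairing {φ : ℕ → EndT} (h0 : φ 0 = MonoidHom.id Circle) {K : ℕ}
    {y : ℕ → Circle} (hy : ∀ l, K < l → y l = 1) {k : ℕ} (hk0 : 0 < k)
    (hk : ¬ IsOfFinOrder (y k)) : IsWeylSequence fun n => pairing K (T^[n] φ) y := by
  classical
  have hle : ∀ l, ¬ IsOfFinOrder (y l) → l ≤ K := fun l hl => by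
    by_contra! h
    exact hl (by rw [hy l h]; exact IsOfFinOrder.one)
  set m := Nat.findGreatest (fun l => ¬ IsOfFinOrder (y l)) K with hm
  have hmk : k ≤ m := Nat.le_findGreatest (hle k hk) hk
  have hms : ¬ IsOfFinOrder (y m) :=
    Nat.findGreatest_spec (P := fun l => ¬ IsOfFinOrder (y l)) (hle k hk) hk
  obtain ⟨i, hi⟩ : ∃ i, m = i + 1 := ⟨m - 1, by omega⟩
  rw [hi] at hms
  refine isWeylSequence_pairing_aux h0 i y hy hms fun l hl => ?_
  by_contra hcon
  have := Nat.le_findGreatest (P := fun l => ¬ IsOfFinOrder (y l)) (hle l hcon) hcon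
  omega

/-! ### Orbits in `𝓗` are dense -/

theorem T_iterate_mem {φ : ℕ → EndT} (hφ : φ ∈ H) (n : ℕ) : T^[n] φ ∈ H := by
  induction n with
  | zero => exact hφ
  | succ n ih => rw [Function.iterate_succ_apply']; exact mem_H_iff_T_mem.1 ih

theorem exists_circle_pow_eq (x : Circle) {n : ℕ} (hn : n ≠ 0) : ∃ y : Circle, y ^ n = x := by
  refine ⟨Circle.exp (Complex.arg x / n), ?_⟩
  have hn' : (n : ℝ) ≠ 0 := by exact_mod_cast hn
  rw [← Circle.exp_natCast_mul, mul_div_cancel₀ _ hn', Circle.exp_arg]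

/-- Along a suitable arithmetic progression, the orbit of any point of `𝓗` agrees with any other
point on given torsion. -/
theorem exists_forall_T_iterate_eq {φ ψ : ℕ → EndT} (hφ : φ ∈ H) (hψ : ψ ∈ H) {N : ℕ}
    (hN : 0 < N) (K : ℕ) : ∃ a M : ℕ, 0 < M ∧ ∀ n k : ℕ, k ≤ K → ∀ x : Circle, x ^ N = 1 →
      (T^[a + M * n] φ) k x = ψ k x := by
  -- The relation in `𝓗` controls `φ_k` only at `k!`-th powers. The factor `K!` ensures that a
  -- `k!`-th root of an `N`-torsion point is `M`-torsion.
  set M := N * K.factorial with hM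
  have hM0 : 0 < M := Nat.mul_pos hN K.factorial_pos
  obtain ⟨m, hmM, hm⟩ := exists_power (φ 1) M hM0
  obtain ⟨m', -, hm'⟩ := exists_power (ψ 1) M hM0
  -- On `M`-torsion `T^n` raises the exponent `m` of `φ_1` to `m + n`, which should be `m'` modulo
  -- `M`; adding `M > m` keeps the natural subtraction from truncating.
  refine ⟨m' + M - m, M, hM0, fun n k hk x hx => ?_⟩
  have hθ := T_iterate_mem hφ (m' + M - m + M * n)
  rcases Nat.eq_zero_or_pos k with rfl | hk0
  · rw [hθ.1, hψ.1]
  obtain ⟨y, rfl⟩ := exists_circle_pow_eq x k.factorial_ne_zero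
  have hy : y ^ M = 1 := by
    obtain ⟨c, hc⟩ := Nat.factorial_dvd_factorial hk
    rw [hM, hc, show N * (k.factorial * c) = k.factorial * N * c by ring, pow_mul, pow_mul, hx,
      one_pow]
  have hθ1 : ∀ z : Circle, z ^ M = 1 → (T^[m' + M - m + M * n] φ) 1 z = z ^ (m' : ℤ) := by
    intro z hz
    rw [T_iterate_one_apply hφ.1, hm z hz, zpow_natCast, zpow_natCast, ← pow_add,
      show m' + M - m + M * n + m = m' + M * (n + 1) by rw [mul_add, mul_one]; omega, pow_add,
      pow_mul, hz, one_pow, mul_one]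
  rw [(mem_H_iff.1 hθ).2 M hM0 m' hθ1 k hk0 y hy, (mem_H_iff.1 hψ).2 M hM0 m' hm' k hk0 y hy]

/-- The torsion of a finitely generated abelian group has bounded order. -/
theorem exists_pow_eq_one_of_isOfFinOrder {G : Type*} [CommGroup G] {s : Set G} (hs : s.Finite) :
    ∃ N : ℕ, 0 < N ∧ ∀ y ∈ Subgroup.closure s, IsOfFinOrder y → y ^ N = 1 := by
  have := hs.to_subtype
  have hfg : Group.FG (Subgroup.closure s) := Group.closure_finite_fg s
  -- Since ℤ is Noetherian, the torsion subgroup is finitely generated, hence finite; its order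
  -- serves as `N`.
  have hadd : (AddSubgroup.toIntSubmodule (M := Additive (Subgroup.closure s))
      (CommGroup.torsion (Subgroup.closure s)).toAddSubgroup).toAddSubgroup.FG :=
    (Submodule.fg_iff_addSubgroup_fg _).1 (IsNoetherian.noetherian _)
  have hfg' : Group.FG (CommGroup.torsion (Subgroup.closure s)) :=
    (Group.fg_iff_subgroup_fg _).2 ((Subgroup.fg_iff_add_fg _).2 hadd)
  have hfin : Finite (CommGroup.torsion (Subgroup.closure s)) :=
    CommGroup.finite_of_fg_isMulTorsion _ fun g => by
      rw [← Submonoid.isOfFinOrder_coe]; exact g.2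
  refine ⟨Nat.card (CommGroup.torsion (Subgroup.closure s)), Nat.card_pos, fun y hy hfo => ?_⟩
  have hmem : (⟨y, hy⟩ : Subgroup.closure s) ∈ CommGroup.torsion (Subgroup.closure s) :=
    Submonoid.isOfFinOrder_coe.1 hfo
  have h := pow_card_eq_one' (x := (⟨_, hmem⟩ : CommGroup.torsion (Subgroup.closure s)))
  exact congrArg (fun z : CommGroup.torsion (Subgroup.closure s) =>
    ((z : Subgroup.closure s) : G)) h

/-- Compactness of the source suffices. Neighbourhoods thereby reduce to conditions on finitely many
pairs `(k, x)`. -/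
theorem isClosedEmbedding_eval :
    IsClosedEmbedding fun (φ : ℕ → EndT) (p : ℕ × Circle) => φ p.1 p.2 := by
  refine Continuous.isClosedEmbedding ?_ fun φ ψ h => ?_
  · exact continuous_pi fun p => (continuous_eval p.2).comp (continuous_apply p.1)
  · funext k
    ext x
    rw [show φ k x = ψ k x from congrFun h (k, x)]

theorem mem_closure_range_T_iterate {φ ψ : ℕ → EndT} (hφ : φ ∈ H) (hψ : ψ ∈ H) :
    ψ ∈ closure (Set.range fun n : ℕ => T^[n] φ) := by
  classical
  rw [isClosedEmbedding_eval.isInducing.closure_eq_preimage_closure_image, Set.mem_preimage,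
    mem_closure_iff]
  intro U hU hψU
  obtain ⟨I, V, hV, hVU⟩ := isOpen_pi_iff.1 hU _ hψU
  let r : (ℕ → EndT) → I → Circle := fun θ i => θ i.1.1 i.1.2
  let proj : I → ((I → Circle) →ₜ* Circle) := fun i => ⟨Pi.evalMonoidHom _ i, continuous_apply i⟩
  set K := I.sup Prod.fst with hK
  have hIK : ∀ i : I, i.1.1 ≤ K := fun i => le_sup (f := Prod.fst) i.2
  set S : Set Circle := Prod.snd '' (I : Set (ℕ × Circle)) with hS
  -- The entries stay in the group generated by the finitely many points `x` involved, so a single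
  -- `N` will annihilate all torsion entries for all characters at once.
  have hchar : ∀ χ ∈ Subgroup.closure (Set.range proj), ∃ y : ℕ → Circle,
      (∀ k, y k ∈ Subgroup.closure S) ∧ (∀ l, K < l → y l = 1) ∧
        ∀ θ, χ (r θ) = pairing K θ y := by
    intro χ hχ
    induction hχ using Subgroup.closure_induction with
    | mem χ hχ =>
      obtain ⟨i, rfl⟩ := hχ
      refine ⟨Pi.mulSingle i.1.1 i.1.2, fun k => ?_, fun l hl => ?_, fun θ => ?_⟩
      · rcases eq_or_ne k i.1.1 with rfl | hk
        · rw [Pi.mulSingle_eq_same]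
          exact Subgroup.subset_closure ⟨i.1, i.2, rfl⟩
        · rw [Pi.mulSingle_eq_of_ne hk]
          exact Subgroup.one_mem _
      · exact Pi.mulSingle_eq_of_ne (by have := hIK i; omega) _
      · rw [pairing_mulSingle (hIK i)]
        rfl
    | one => exact ⟨1, fun _ => Subgroup.one_mem _, fun _ _ => rfl, fun θ => by simp [pairing]⟩
    | mul χ χ' _ _ h h' =>
      obtain ⟨y, h1, h2, h3⟩ := h
      obtain ⟨z, h1', h2', h3'⟩ := h'
      refine ⟨y * z, fun k => Subgroup.mul_mem _ (h1 k) (h1' k), fun l hl => ?_, fun θ => ?_⟩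
      · rw [Pi.mul_apply, h2 l hl, h2' l hl, one_mul]
      · rw [pairing_mul_right, ← h3, ← h3']
        rfl
    | inv χ _ h =>
      obtain ⟨y, h1, h2, h3⟩ := h
      refine ⟨y⁻¹, fun k => Subgroup.inv_mem _ (h1 k), fun l hl => ?_, fun θ => ?_⟩
      · rw [Pi.inv_apply, h2 l hl, inv_one]
      · rw [pairing_inv_right, ← h3]
        rfl
  obtain ⟨N, hN0, hN⟩ := exists_pow_eq_one_of_isOfFinOrder (I.finite_toSet.image Prod.snd)
  obtain ⟨a, M, hM0, hagree⟩ := exists_forall_T_iterate_eq hφ hψ hN0 K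
  have hone : (1 : I → Circle) ∈ closure (Set.range fun n => r (T^[a + M * n] φ) / r ψ) := by
    refine one_mem_closure_range_of_characters (Subgroup.closure (Set.range proj)) ?_ _ ?_
    · intro x y hxy
      obtain ⟨i, hi⟩ := Function.ne_iff.1 hxy
      exact ⟨proj i, Subgroup.subset_closure ⟨i, rfl⟩, hi⟩
    · intro χ hχ
      obtain ⟨y, h1, h2, h3⟩ := hchar χ hχ
      simp only [map_div, h3]
      -- If all entries at positive indices are torsion, the progression matches `ψ` exactly;
      -- otherwise the sequence is Weyl and averages to 0.
      by_cases htor : ∀ k, 0 < k → IsOfFinOrder (y k)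
      · left
        intro n
        rw [div_eq_one, pairing, pairing]
        refine prod_congr rfl fun k hk => ?_
        rcases Nat.eq_zero_or_pos k with rfl | hk0
        · rw [T_iterate_zero, hφ.1, hψ.1]
        · exact hagree n k (Nat.lt_succ_iff.1 (mem_range.1 hk)) _ (hN _ (h1 k) (htor k hk0))
      · right
        push Not at htor
        obtain ⟨k, hk0, hk⟩ := htor
        have := (((isWeylSequence_pairing hφ.1 h2 hk0 hk).comp_add_mul a hM0).const_mul
          (pairing K ψ y)⁻¹).tendsto_average
        simpa only [div_eq_inv_mul] using this
  have hopen : IsOpen {z : I → Circle | ∀ i : I, z i * r ψ i ∈ V i.1} := by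
    rw [Set.ofPred_forall]
    exact isOpen_iInter_of_finite fun i =>
      (hV i.1 i.2).1.preimage ((continuous_apply i).mul continuous_const)
  obtain ⟨_, hz, n, rfl⟩ := mem_closure_iff.1 hone _ hopen
    (fun i => by rw [Pi.one_apply, one_mul]; exact (hV i.1 i.2).2)
  refine ⟨_, hVU fun p hp => ?_, _, ⟨a + M * n, rfl⟩, rfl⟩
  have := hz ⟨p, hp⟩
  simpa only [Pi.div_apply, div_mul_cancel] using this

theorem TH_iterate_coe (n : ℕ) (x : H) : ((TH^[n] x : H) : ℕ → EndT) = T^[n] x := by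
  induction n with
  | zero => rfl
  | succ n ih => rw [Function.iterate_succ_apply', Function.iterate_succ_apply', ← ih]; rfl

theorem denseRange_TH_iterate (x : H) : DenseRange fun n : ℕ => TH^[n] x := by
  intro y
  rw [Topology.IsInducing.subtypeVal.closure_eq_preimage_closure_image, Set.mem_preimage,
    ← Set.range_comp]
  have : (Subtype.val ∘ fun n : ℕ => TH^[n] x) = fun n : ℕ => T^[n] (x : ℕ → EndT) :=
    funext fun n => TH_iterate_coe n x
  rw [this]
  exact mem_closure_range_T_iterate x.2 y.2

/-- The point `(id, 1, 1, …)` of `𝓗`. -/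
noncomputable def basePoint : H :=
  ⟨Pi.mulSingle 0 (MonoidHom.id Circle), mem_H_iff.2 ⟨by simp, fun N _ m hm k hk x hx => by
    have h1 : ∀ l, 0 < l → (Pi.mulSingle 0 (MonoidHom.id Circle) : ℕ → EndT) l = 1 :=
      fun l hl => Pi.mulSingle_eq_of_ne hl.ne' _
    have hdvd : ∀ y : Circle, y ^ N = 1 → y ^ m = 1 := fun y hy => by
      rw [← hm y hy, h1 1 one_pos]; rfl
    have := prod_stirling (f := 1) (N := N) (m := m) (fun y hy => by rw [hdvd y hy]; rfl) hx hk
    rw [← this, h1 k hk, prod_eq_one]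
    · rfl
    · intro j hj
      obtain ⟨i, rfl⟩ : ∃ i, j = i + 1 := ⟨j - 1, by have := (mem_Icc.1 hj).1; omega⟩
      rw [Function.iterate_succ_apply']
      rfl⟩⟩

theorem isMinimalSystem_TH : IsMinimalSystem TH := by
  refine ⟨⟨basePoint⟩, fun A hA ⟨x, hx⟩ hTA => ?_⟩
  have hmem : ∀ n : ℕ, TH^[n] x ∈ A := by
    intro n
    induction n with
    | zero => exact hx
    | succ n ih => rw [Function.iterate_succ_apply', ← hTA]; exact ⟨_, ih, rfl⟩
  refine Set.eq_univ_of_univ_subset ?_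
  rw [← (denseRange_TH_iterate x).closure_range]
  exact hA.closure_subset_iff.2 (Set.range_subset_iff.2 hmem)

/-! ### Quasi-eigenfunctions -/

section QuasiEigen

variable {X Y : Type*} [TopologicalSpace X] [TopologicalSpace Y]

theorem quasiEigen_mono_succ (s : X ≃ₜ X) (m : ℕ) : quasiEigen s m ⊆ quasiEigen s (m + 1) := by
  induction m with
  | zero =>
    rintro g ⟨c, hc⟩
    exact ⟨1, ⟨1, fun _ => rfl⟩, fun x => by simp [hc]⟩
  | succ m ih =>
    rintro g ⟨f, hf, hg⟩
    exact ⟨f, ih hf, hg⟩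

theorem quasiEigen_mono (s : X ≃ₜ X) : Monotone (quasiEigen s) :=
  monotone_nat_of_le_succ (quasiEigen_mono_succ s)

theorem mul_mem_quasiEigen (s : X ≃ₜ X) {m : ℕ} {f g : C(X, Circle)} (hf : f ∈ quasiEigen s m)
    (hg : g ∈ quasiEigen s m) : f * g ∈ quasiEigen s m := by
  induction m generalizing f g with
  | zero =>
    obtain ⟨c, hc⟩ := hf
    obtain ⟨d, hd⟩ := hg
    exact ⟨c * d, fun x => by simp [hc, hd]⟩
  | succ m ih =>
    obtain ⟨f', hf', hf⟩ := hf
    obtain ⟨g', hg', hg⟩ := hg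
    exact ⟨f' * g', ih hf' hg', fun x => by simp [hf, hg, mul_mul_mul_comm]⟩

theorem inv_mem_quasiEigen (s : X ≃ₜ X) {m : ℕ} {f : C(X, Circle)} (hf : f ∈ quasiEigen s m) :
    f⁻¹ ∈ quasiEigen s m := by
  induction m generalizing f with
  | zero =>
    obtain ⟨c, hc⟩ := hf
    exact ⟨c⁻¹, fun x => by simp [hc]⟩
  | succ m ih =>
    obtain ⟨f', hf', hf⟩ := hf
    exact ⟨f'⁻¹, ih hf', fun x => by simp [hf, mul_comm]⟩

theorem quasiEigenfunctions_eq (s : X ≃ₜ X) :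
    quasiEigenfunctions s = toComplex '' ⋃ m, quasiEigen s m := by
  ext F
  constructor
  · rintro ⟨m, g, hg, hF⟩
    exact ⟨g, Set.mem_iUnion.2 ⟨m, hg⟩, by ext x; exact (hF x).symm⟩
  · rintro ⟨g, hg, rfl⟩
    obtain ⟨m, hm⟩ := Set.mem_iUnion.1 hg
    exact ⟨m, g, hm, fun _ => rfl⟩

/-- A system whose quasi-eigenfunctions separate points has quasi-discrete spectrum. -/
theorem hasQuasiDiscreteSpectrum_of_separating [CompactSpace X] (s : X ≃ₜ X)
    (hsep : ∀ x y : X, x ≠ y → ∃ m, ∃ g ∈ quasiEigen s m, g x ≠ g y) :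
    HasQuasiDiscreteSpectrum s := by
  rw [HasQuasiDiscreteSpectrum, quasiEigenfunctions_eq]
  refine dense_span_of_separating _ ?_ ?_ ?_ ?_
  · exact Set.mem_iUnion.2 ⟨0, 1, fun _ => rfl⟩
  · intro f hf g hg
    obtain ⟨m, hm⟩ := Set.mem_iUnion.1 hf
    obtain ⟨n, hn⟩ := Set.mem_iUnion.1 hg
    exact Set.mem_iUnion.2 ⟨max m n, mul_mem_quasiEigen s (quasiEigen_mono s (le_max_left m n) hm)
      (quasiEigen_mono s (le_max_right m n) hn)⟩
  · intro f hf
    obtain ⟨m, hm⟩ := Set.mem_iUnion.1 hf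
    exact Set.mem_iUnion.2 ⟨m, inv_mem_quasiEigen s hm⟩
  · intro x y hxy
    obtain ⟨m, g, hg, hne⟩ := hsep x y hxy
    exact ⟨g, Set.mem_iUnion.2 ⟨m, hg⟩, hne⟩

/-- The quasi-eigenfunctions of a system with quasi-discrete spectrum separate points. -/
theorem HasQuasiDiscreteSpectrum.separating [CompactSpace X] [T2Space X] {s : X ≃ₜ X}
    (hs : HasQuasiDiscreteSpectrum s) {x y : X}
    (h : ∀ m, ∀ g ∈ quasiEigen s m, g x = g y) : x = y := by
  have hall : ∀ F : C(X, ℂ), F x = F y := by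
    have hspan : ∀ F ∈ Submodule.span ℂ (quasiEigenfunctions s), F x = F y := by
      intro F hF
      induction hF using Submodule.span_induction with
      | mem F hF =>
        obtain ⟨m, g, hg, hF⟩ := hF
        rw [hF, hF, h m g hg]
      | zero => rfl
      | add F F' _ _ h h' => simp [h, h']
      | smul c F _ h => simp [h]
    have hcl : IsClosed {F : C(X, ℂ) | F x = F y} :=
      isClosed_eq (continuous_eval_const x) (continuous_eval_const y)
    intro F
    exact hcl.closure_subset_iff.2 hspan (hs F)
  by_contra hxy
  obtain ⟨f, hf0, hf1, -⟩ := exists_continuous_zero_one_of_isClosed (isClosed_singleton (x := x))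
    (isClosed_singleton (x := y)) (Set.disjoint_singleton.2 hxy)
  have := hall ⟨fun z => (f z : ℂ), by fun_prop⟩
  simp only [ContinuousMap.coe_mk, hf0 (Set.mem_singleton x), hf1 (Set.mem_singleton y)] at this
  simp at this

/-- Along orbits, quasi-eigenfunctions are governed by the dual shift. -/
theorem exists_dualShift_of_mem_quasiEigen (t : Y ≃ₜ Y) {m : ℕ} {f : C(Y, Circle)}
    (hf : f ∈ quasiEigen t m) : ∃ a : Y → ℕ → Circle, (∀ y, a y 0 = f y) ∧
      (∀ y l, m < l → a y l = 1) ∧ ∀ y, a (t y) = dualShift (a y) := by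
  induction m generalizing f with
  | zero =>
    obtain ⟨c, hc⟩ := hf
    refine ⟨fun _ => Pi.mulSingle 0 c, fun y => by simp [hc],
      fun y l hl => Pi.mulSingle_eq_of_ne hl.ne' _, fun y => ?_⟩
    funext l
    simp
  | succ m ih =>
    obtain ⟨g, hg, hfg⟩ := hf
    obtain ⟨b, hb0, hb1, hb⟩ := ih hg
    -- The sequence of `f` is that of its multiplier `g` with `f y` put in front.
    refine ⟨fun y l => Nat.casesOn l (f y) (b y), fun _ => rfl, fun y l hl => ?_, fun y => ?_⟩
    · obtain ⟨l, rfl⟩ : ∃ i, l = i + 1 := ⟨l - 1, by omega⟩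
      exact hb1 y l (by omega)
    · funext l
      cases l with
      | zero => simp [hfg, hb0, mul_comm]
      | succ l => simp [hb]

end QuasiEigen

/-! ### `𝓗` has quasi-discrete spectrum -/

/-- The `k`-th coordinate at `x` is the multiplier of the next one, and `φ_0 = id` makes the zeroth
constant. -/
theorem eval_mem_quasiEigen (k : ℕ) (x : Circle) :
    (⟨fun φ : H => (φ : ℕ → EndT) k x, (continuous_eval x).comp
      ((continuous_apply k).comp continuous_subtype_val)⟩ : C(H, Circle)) ∈ quasiEigen TH k := by
  induction k with
  | zero => exact ⟨x, fun φ => by change (φ : ℕ → EndT) 0 x = x; rw [φ.2.1]; rfl⟩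
  | succ k ih => exact ⟨_, ih, fun φ => rfl⟩

theorem hasQuasiDiscreteSpectrum_TH : HasQuasiDiscreteSpectrum TH := by
  refine hasQuasiDiscreteSpectrum_of_separating TH fun φ ψ hne => ?_
  by_contra! h
  refine hne (Subtype.ext (funext fun k => MonoidHom.ext fun x => ?_))
  exact h k _ (eval_mem_quasiEigen k x)

/-! ### Universality -/

theorem pairing_basePoint (K : ℕ) (y : ℕ → Circle) : pairing K basePoint y = y 0 := by
  rw [pairing, prod_range_succ', prod_eq_one, one_mul]
  · simp [basePoint]
  · intro k _
    simp [basePoint]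

/-- Two points on the closure of the joint orbit of `(basePoint, y₀)` with the same first
coordinate coincide. -/
theorem eq_pairing_of_mem_closure {Y : Type*} [TopologicalSpace Y] (t : Y ≃ₜ Y) (y₀ : Y)
    {f : C(Y, Circle)} {K : ℕ} {a : Y → ℕ → Circle} (ha0 : ∀ y, a y 0 = f y)
    (ha1 : ∀ y l, K < l → a y l = 1) (ha : ∀ y, a (t y) = dualShift (a y)) {p : H × Y}
    (hp : p ∈ closure (Set.range fun n : ℕ => (TH^[n] basePoint, t^[n] y₀))) :
    f p.2 = pairing K p.1 (a y₀) := by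
  -- The identity is closed in `p`, and on the orbit both sides are the zeroth entry of
  -- `dualShift^[n] (a y₀)`.
  have hcl : IsClosed {p : H × Y | f p.2 = pairing K p.1 (a y₀)} :=
    isClosed_eq (f.continuous.comp continuous_snd)
      ((continuous_pairing K _).comp (continuous_subtype_val.comp continuous_fst))
  refine hcl.closure_subset_iff.2 ?_ hp
  rintro _ ⟨n, rfl⟩
  have hit : a (t^[n] y₀) = dualShift^[n] (a y₀) := by
    induction n with
    | zero => rfl
    | succ n ih => rw [Function.iterate_succ_apply', Function.iterate_succ_apply', ha, ih]
  change f (t^[n] y₀) = pairing K (TH^[n] basePoint : H) (a y₀)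
  rw [TH_iterate_coe, pairing_T_iterate _ (ha1 y₀), pairing_basePoint, ← hit, ha0]

/-- Over a point of `𝓗` in the joint orbit closure, all quasi-eigenfunctions of `Y` have prescribed
values, and they separate points; so the closure is a graph over `𝓗`. Compactness makes the
resulting map continuous, and minimality of `Y` makes it onto. -/
theorem isFactorOf_TH {Y : Type*} [TopologicalSpace Y] [CompactSpace Y] [T2Space Y] (t : Y ≃ₜ Y)
    (ht : IsMinimalSystem t) (hq : HasQuasiDiscreteSpectrum t) : IsFactorOf t TH := by
  obtain ⟨⟨y₀⟩, hmin⟩ := ht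
  set Z : Set (H × Y) := closure (Set.range fun n : ℕ => (TH^[n] basePoint, t^[n] y₀)) with hZ
  have : CompactSpace Z := isCompact_iff_compactSpace.1 isClosed_closure.isCompact
  have hinj : Function.Injective fun z : Z => z.1.1 := by
    rintro ⟨⟨φ, y⟩, hz⟩ ⟨⟨ψ, y'⟩, hz'⟩ h
    obtain rfl : φ = ψ := h
    have : y = y' := hq.separating fun m g hg => by
      obtain ⟨a, ha0, ha1, ha⟩ := exists_dualShift_of_mem_quasiEigen t hg
      rw [eq_pairing_of_mem_closure t y₀ ha0 ha1 ha hz,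
        eq_pairing_of_mem_closure t y₀ ha0 ha1 ha hz']
    subst this
    rfl
  have hcont : Continuous fun z : Z => z.1.1 := continuous_fst.comp continuous_subtype_val
  have hsurj : Function.Surjective fun z : Z => z.1.1 := by
    rw [← Set.range_eq_univ, ← (isCompact_range hcont).isClosed.closure_eq]
    refine Set.eq_univ_of_univ_subset ?_
    rw [← (denseRange_TH_iterate basePoint).closure_range]
    refine closure_mono ?_
    rintro _ ⟨n, rfl⟩
    exact ⟨⟨_, subset_closure ⟨n, rfl⟩⟩, rfl⟩
  let e : Z ≃ₜ H :=
    Continuous.homeoOfEquivCompactToT2 (f := Equiv.ofBijective _ ⟨hinj, hsurj⟩) hcont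
  have hstep : ∀ z : Z, (TH z.1.1, t z.1.2) ∈ Z := by
    intro z
    have hmaps : Set.MapsTo (Prod.map TH t)
        (Set.range fun n : ℕ => (TH^[n] basePoint, t^[n] y₀))
        (Set.range fun n : ℕ => (TH^[n] basePoint, t^[n] y₀)) := by
      rintro _ ⟨n, rfl⟩
      exact ⟨n + 1, by simp only [Function.iterate_succ_apply', Prod.map_apply]⟩
    exact hmaps.closure (TH.continuous.prodMap t.continuous) z.2
  let π : H → Y := fun φ => (e.symm φ).1.2
  have hπc : Continuous π :=
    continuous_snd.comp (continuous_subtype_val.comp e.symm.continuous)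
  have hequi : ∀ φ, π (TH φ) = t (π φ) := by
    intro φ
    have h1 : e ⟨_, hstep (e.symm φ)⟩ = TH φ := congrArg TH (e.apply_symm_apply φ)
    change (e.symm (TH φ)).1.2 = _
    rw [← h1, e.symm_apply_apply]
  refine ⟨π, hπc, ?_, hequi⟩
  rw [← Set.range_eq_univ]
  refine hmin _ (isCompact_range hπc).isClosed ⟨_, basePoint, rfl⟩ ?_
  rw [← Set.range_comp, ← TH.surjective.range_comp π]
  congr 1
  funext φ
  exact (hequi φ).symm

/-! ### Endomorphisms of `(𝓗, T)` are injective -/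

/-- A homomorphism of `(𝓗, T)` to itself maps `φ` to `(∏_{j ≤ k} φ_j ∘ η_{k-j})_k`, where `η` is
the image of the base point. -/
theorem endomorphism_apply {π : H → H} (hπ : IsSystemHom TH TH π) (φ : H) (k : ℕ) (x : Circle) :
    (π φ : ℕ → EndT) k x =
      ∏ j ∈ range (k + 1), (φ : ℕ → EndT) j ((π basePoint : ℕ → EndT) (k - j) x) := by
  -- Coordinates are listed downwards from `k`, each followed by its multiplier. The cutoff at `l ≤
  -- k` is essential, since truncated subtraction would otherwise repeat `ψ_0(x) = x` forever.
  let a : H → ℕ → Circle := fun ψ l => if l ≤ k then (ψ : ℕ → EndT) (k - l) x else 1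
  have ha : ∀ ψ, a (TH ψ) = dualShift (a ψ) := by
    intro ψ
    funext l
    simp only [a, dualShift_apply]
    rcases lt_trichotomy l k with hl | rfl | hl
    · obtain ⟨i, hi⟩ : ∃ i, k - l = i + 1 := ⟨k - l - 1, by omega⟩
      rw [if_pos hl.le, if_pos hl.le, if_pos (by omega), hi, show k - (l + 1) = i by omega,
        mul_comm]
      rfl
    · simp only [le_refl, if_true, Nat.sub_self, (TH ψ).2.1, ψ.2.1]
      simp
    · simp [Nat.not_le.2 hl, show ¬ l + 1 ≤ k by omega]
  have hit : ∀ n : ℕ, π (TH^[n] basePoint) = TH^[n] (π basePoint) := by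
    intro n
    induction n with
    | zero => rfl
    | succ n ih =>
      rw [Function.iterate_succ_apply', Function.iterate_succ_apply', hπ.equivariant, ih]
  -- By continuity of `π` and density of the base orbit, the graph of `π` lies in the joint orbit
  -- closure.
  have hmem : (φ, π φ) ∈ closure
      (Set.range fun n : ℕ => (TH^[n] basePoint, TH^[n] (π basePoint))) := by
    have := (denseRange_TH_iterate basePoint) φ
    have h2 := image_closure_subset_closure_image (s := Set.range fun n : ℕ => TH^[n] basePoint)
      (continuous_id.prodMk hπ.continuous) ⟨φ, this, rfl⟩
    rw [← Set.range_comp] at h2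
    have h3 : ((fun ψ : H => (id ψ, π ψ)) ∘ fun n : ℕ => TH^[n] basePoint)
        = fun n : ℕ => (TH^[n] basePoint, TH^[n] (π basePoint)) :=
      funext fun n => Prod.ext rfl (hit n)
    rwa [h3] at h2
  have h := eq_pairing_of_mem_closure TH (π basePoint)
    (f := ⟨fun φ : H => (φ : ℕ → EndT) k x, (continuous_eval x).comp
      ((continuous_apply k).comp continuous_subtype_val)⟩) (K := k) (a := a)
    (fun ψ => by simp [a]) (fun ψ l hl => by simp [a, Nat.not_le.2 hl]) ha hmem
  change (π φ : ℕ → EndT) k x = _ at h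
  rw [h, pairing]
  refine prod_congr rfl fun j hj => ?_
  simp only [a]
  rw [if_pos (Nat.lt_succ_iff.1 (mem_range.1 hj))]

/-- In the product formula for `(π φ)_k` the factor `j = k` is `φ_k(x)` itself, as `η_0 = id`, and
the others involve only earlier coordinates; so `φ` is recovered recursively from `π φ`. -/
theorem IsSystemHom.injective_of_TH {π : H → H} (hπ : IsSystemHom TH TH π) :
    Function.Injective π := by
  intro φ ψ h
  refine Subtype.ext (funext fun k => ?_)
  induction k using Nat.strong_induction_on with
  | _ k ih =>
    ext x
    have h1 := endomorphism_apply hπ φ k x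
    rw [h, endomorphism_apply hπ ψ k x, prod_range_succ, prod_range_succ,
      prod_congr rfl fun j hj => by rw [← ih j (mem_range.1 hj)], Nat.sub_self,
      (π basePoint).2.1] at h1
    rw [show (φ : ℕ → EndT) k x = (ψ : ℕ → EndT) k x from (mul_left_cancel h1).symm]

/-! ### Transport to another universe -/

theorem isMinimalSystem_of_conj {X Y : Type*} [TopologicalSpace X] [TopologicalSpace Y]
    (e : X ≃ₜ Y) {s : X ≃ₜ X} (hs : IsMinimalSystem s) :
    IsMinimalSystem ((e.symm.trans s).trans e) := by
  obtain ⟨⟨x⟩, hs⟩ := hs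
  refine ⟨⟨e x⟩, fun A hA hne hinv => ?_⟩
  have h := hs (e ⁻¹' A) (hA.preimage e.continuous)
    (hne.preimage e.surjective) (by
      conv_rhs => rw [← hinv]
      ext z
      simp only [Set.mem_image, Set.mem_preimage, Homeomorph.trans_apply]
      constructor
      · rintro ⟨w, hw, rfl⟩
        exact ⟨e w, hw, by simp⟩
      · rintro ⟨w, hw, h⟩
        exact ⟨e.symm w, by simpa using hw, e.injective h⟩)
  rw [← Set.image_preimage_eq A e.surjective, h, Set.image_univ, e.surjective.range_eq]

theorem quasiEigen_conj {X Y : Type*} [TopologicalSpace X] [TopologicalSpace Y] (e : X ≃ₜ Y)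
    (s : X ≃ₜ X) {m : ℕ} {g : C(X, Circle)} (hg : g ∈ quasiEigen s m) :
    g.comp (e.symm : C(Y, X)) ∈ quasiEigen ((e.symm.trans s).trans e) m := by
  induction m generalizing g with
  | zero =>
    obtain ⟨c, hc⟩ := hg
    exact ⟨c, fun y => hc _⟩
  | succ m ih =>
    obtain ⟨f, hf, hg⟩ := hg
    exact ⟨_, ih hf, fun y => by simp [hg]⟩

theorem hasQuasiDiscreteSpectrum_of_conj {X Y : Type*} [TopologicalSpace X] [CompactSpace X]
    [T2Space X] [TopologicalSpace Y] [CompactSpace Y] (e : X ≃ₜ Y) {s : X ≃ₜ X}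
    (hs : HasQuasiDiscreteSpectrum s) :
    HasQuasiDiscreteSpectrum ((e.symm.trans s).trans e) := by
  refine hasQuasiDiscreteSpectrum_of_separating _ fun x y hxy => ?_
  by_contra! h
  exact hxy (e.symm.injective (hs.separating fun m g hg => h m _ (quasiEigen_conj e s hg)))

end TopDyn

/-- The system `(𝓗, T)` is the universal minimal system with quasi-discrete spectrum, and any
other universal minimal system with quasi-discrete spectrum is isomorphic to it. -/
theorem mainTheorem5 :
    TopDyn.IsUniversalMinimalQDS.{u, 0} TopDyn.TH ∧
      ∀ (Y : Type v) [TopologicalSpace Y] [CompactSpace Y] [T2Space Y] (t : Y ≃ₜ Y),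
        TopDyn.IsUniversalMinimalQDS.{u, v} t → TopDyn.IsIsomorphicTo TopDyn.TH t := by
  refine ⟨⟨TopDyn.isMinimalSystem_TH, TopDyn.hasQuasiDiscreteSpectrum_TH,
    fun Y _ _ _ t ht hq => TopDyn.isFactorOf_TH t ht hq⟩, fun Y _ _ _ t ⟨ht, hq, huniv⟩ => ?_⟩
  -- Universality of `t` ranges over systems in universe `u`, so it is applied to a lifted copy of
  -- `𝓗`.
  let e : TopDyn.H ≃ₜ ULift.{u} TopDyn.H := Homeomorph.ulift.symm
  have : CompactSpace (ULift.{u} TopDyn.H) := e.compactSpace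
  have : T2Space (ULift.{u} TopDyn.H) := e.t2Space
  obtain ⟨ρ, hρ⟩ := huniv (ULift.{u} TopDyn.H) ((e.symm.trans TopDyn.TH).trans e)
    (TopDyn.isMinimalSystem_of_conj e TopDyn.isMinimalSystem_TH)
    (TopDyn.hasQuasiDiscreteSpectrum_of_conj e TopDyn.hasQuasiDiscreteSpectrum_TH)
  obtain ⟨π, hπ⟩ := TopDyn.isFactorOf_TH t ht hq
  have hcomp : TopDyn.IsSystemHom TopDyn.TH TopDyn.TH fun φ => e.symm (ρ (π φ)) :=
    ⟨e.symm.continuous.comp (hρ.continuous.comp hπ.continuous),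
      e.symm.surjective.comp (hρ.surjective.comp hπ.surjective), fun φ => by
        rw [hπ.equivariant, hρ.equivariant]
        simp⟩
  exact ⟨π, hπ, fun φ ψ h => hcomp.injective_of_TH (by simp only [h])⟩
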